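/- Let $\mathcal O_2=\mathbb C\{x,y\}$ be the ring of germs of holomorphic functions at $0\in\mathbb C^2$, and $\mathfrak m$ its maximal ideal. For $g\in\mathcal O_2$ and an integer $k\ge 0$, the $k$-th Tjurina number of the germ $C=\{g=0\}$ is $$\tau^k(C)=\dim_{\mathbb C}\frac{\mathcal O_2}{\mathfrak m^k\langle g_x,g_y\rangle+\langle g\rangle},$$ and, for $g\neq 0$, $\nu(g)$ denotes the algebraic multiplicity of $g$, i.e. the least degree of a monomial occurring in $g$. For rational numbers $a,b>0$ put $$\ell^k(a,b)=\begin{cases}(a-1)(b-1)+\dfrac{k(k+3)}2, & 0\le k<a,\\[4pt] (a-1)(b-1)+\dfrac{k(k+3)}2-\dfrac{(k-a+2)(k-a+1)}2, & k\ge a.\end{cases}$$ A polynomial $f\in\mathbb C[x,y]$ is weighted homogeneous of weight type $(w_1,w_2;1)$, with $w_1,w_2$ positive rational numbers, if $w_1i+w_2j=1$ for every monomial $x^iy^j$ occurring in $f$. Theorem. (1) For all integers $1\le a\le b$ and $k\ge 0$, the number $\tau^k(\{x^a+y^b=0\})$ is finite and equals $\ell^k(a,b)$. (2) Let $C=\{f=0\}$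 be a germ at $0\in\mathbb C^2$ of a reduced plane curve (that is, $f$ is nonzero and squarefree in $\mathcal O_2$) defined by a weighted homogeneous polynomial $f$ of weight type $(w_1,w_2;1)$ such that $\nu(f)\ge 1/w_1$. Then for every integer $k\ge 0$ the number $\tau^k(C)$ is finite and $$\tau^k(C)\ \ge\ \ell^k\!\left(\frac1{w_1},\frac1{w_2}\right).$$ -/

import Mathlib

noncomputable section

namespace PlaneCurve

/-- Absolute convergence of a power series in two variables near the origin of `ℂ²`:
`∑ |a_{ij}| r^{i+j} < ∞` for some radius `r > 0`. -/
def IsConvergent (f : MvPowerSeries (Fin 2) ℂ) : Prop :=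
  ∃ r : ℝ, 0 < r ∧ Summable fun d : Fin 2 →₀ ℕ => ‖MvPowerSeries.coeff d f‖ * r ^ d.degree

theorem IsConvergent.mono {f : MvPowerSeries (Fin 2) ℂ} {r s : ℝ} (hs : 0 < s) (hsr : s ≤ r)
    (h : Summable fun d : Fin 2 →₀ ℕ => ‖MvPowerSeries.coeff d f‖ * r ^ d.degree) :
    Summable fun d : Fin 2 →₀ ℕ => ‖MvPowerSeries.coeff d f‖ * s ^ d.degree :=
  Summable.of_nonneg_of_le (fun d => by positivity) (fun d => by gcongr) h

theorem isConvergent_coe (p : MvPolynomial (Fin 2) ℂ) :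
    IsConvergent (p : MvPowerSeries (Fin 2) ℂ) := by
  refine ⟨1, one_pos, summable_of_ne_finset_zero (s := p.support) fun d hd => ?_⟩
  rw [MvPolynomial.coeff_coe, MvPolynomial.notMem_support_iff.mp hd]
  simp

theorem IsConvergent.add {f g : MvPowerSeries (Fin 2) ℂ} (hf : IsConvergent f)
    (hg : IsConvergent g) : IsConvergent (f + g) := by
  obtain ⟨r, hr, hf⟩ := hf
  obtain ⟨s, hs, hg⟩ := hg
  have ht : 0 < min r s := lt_min hr hs
  refine ⟨min r s, ht, Summable.of_nonneg_of_le (fun d => by positivity) (fun d => ?_)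
    ((IsConvergent.mono ht (min_le_left r s) hf).add (IsConvergent.mono ht (min_le_right r s) hg))⟩
  rw [map_add, ← add_mul]
  gcongr
  exact norm_add_le _ _

theorem summable_coeff_mul {f g : MvPowerSeries (Fin 2) ℂ} {t : ℝ} (ht : 0 ≤ t)
    (hf : Summable fun d : Fin 2 →₀ ℕ => ‖MvPowerSeries.coeff d f‖ * t ^ d.degree)
    (hg : Summable fun d : Fin 2 →₀ ℕ => ‖MvPowerSeries.coeff d g‖ * t ^ d.degree) :
    Summable fun d : Fin 2 →₀ ℕ => ‖MvPowerSeries.coeff d (f * g)‖ * t ^ d.degree := by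
  have hnn (h : MvPowerSeries (Fin 2) ℂ) (d : Fin 2 →₀ ℕ) :
      0 ≤ ‖MvPowerSeries.coeff d h‖ * t ^ d.degree :=
    mul_nonneg (norm_nonneg _) (pow_nonneg ht _)
  have key := summable_sum_mul_antidiagonal_of_summable_mul
    (Summable.mul_of_nonneg hf hg (hnn f) (hnn g))
  refine Summable.of_nonneg_of_le (hnn (f * g)) (fun d => ?_) key
  have h1 : ‖MvPowerSeries.coeff d (f * g)‖ ≤ ∑ p ∈ Finset.HasAntidiagonal.antidiagonal d,
      ‖MvPowerSeries.coeff p.1 f * MvPowerSeries.coeff p.2 g‖ := by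
    rw [MvPowerSeries.coeff_mul]
    exact norm_sum_le _ _
  refine (mul_le_mul_of_nonneg_right h1 (pow_nonneg ht _)).trans (le_of_eq ?_)
  rw [Finset.sum_mul]
  refine Finset.sum_congr rfl fun p hp => ?_
  have h2 : d.degree = p.1.degree + p.2.degree := by
    rw [← Finset.HasAntidiagonal.mem_antidiagonal.mp hp, map_add]
  rw [h2, pow_add, norm_mul, mul_mul_mul_comm]

theorem IsConvergent.mul {f g : MvPowerSeries (Fin 2) ℂ} (hf : IsConvergent f)
    (hg : IsConvergent g) : IsConvergent (f * g) := by
  obtain ⟨r, hr, hf⟩ := hf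
  obtain ⟨s, hs, hg⟩ := hg
  have ht : 0 < min r s := lt_min hr hs
  exact ⟨min r s, ht, summable_coeff_mul ht.le (IsConvergent.mono ht (min_le_left r s) hf)
    (IsConvergent.mono ht (min_le_right r s) hg)⟩

theorem IsConvergent.pderiv {f : MvPowerSeries (Fin 2) ℂ} (hf : IsConvergent f) (i : Fin 2) :
    IsConvergent (MvPowerSeries.pderiv ℂ i f) := by
  obtain ⟨r, hr, hf⟩ := hf
  have hinj : Function.Injective fun d : Fin 2 →₀ ℕ => d + Finsupp.single i 1 :=
    add_left_injective _
  have key := (hf.comp_injective hinj).mul_left (1 / r)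
  refine ⟨r / 2, by positivity, Summable.of_nonneg_of_le (fun d => by positivity) (fun d => ?_)
    key⟩
  have h1 : ((d i : ℝ) + 1) ≤ 2 ^ d.degree := by
    have h2 : d i ≤ d.degree := Finsupp.le_degree i d
    have h3 : d.degree < 2 ^ d.degree := Nat.lt_two_pow_self
    exact_mod_cast (by omega : d i + 1 ≤ 2 ^ d.degree)
  have h4 : ‖((d i : ℂ) + 1)‖ = (d i : ℝ) + 1 := by
    have : ((d i : ℂ) + 1) = ((d i + 1 : ℕ) : ℂ) := by push_cast; ring
    rw [this, Complex.norm_natCast]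
    push_cast
    ring
  simp only [Function.comp]
  rw [MvPowerSeries.coeff_pderiv, norm_mul, h4, map_add, Finsupp.degree_single, pow_succ, div_pow]
  have h5 : 1 / r * (‖MvPowerSeries.coeff (d + Finsupp.single i 1) f‖ * (r ^ d.degree * r)) =
      ‖MvPowerSeries.coeff (d + Finsupp.single i 1) f‖ * 2 ^ d.degree *
        (r ^ d.degree / 2 ^ d.degree) := by
    field_simp
  rw [h5]
  gcongr

/-- The `ℂ`-algebra `ℂ{x, y}` of convergent power series. -/
def convergentSeries : Subalgebra ℂ (MvPowerSeries (Fin 2) ℂ) where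
  carrier := {f | IsConvergent f}
  mul_mem' := IsConvergent.mul
  add_mem' := IsConvergent.add
  algebraMap_mem' c := by
    have h := isConvergent_coe (MvPolynomial.C c)
    rwa [MvPolynomial.coe_C] at h

/-- `𝒪₂ = ℂ{x, y}`, the ring of germs of holomorphic functions at the origin of `ℂ²`. -/
abbrev O2 : Type := convergentSeries

/-- The ideal `𝔪 = {f ∈ 𝒪₂ : f(0) = 0}`. -/
def maxIdeal : Ideal O2 :=
  RingHom.ker ((MvPowerSeries.constantCoeff (σ := Fin 2) (R := ℂ)).comp
    convergentSeries.val.toRingHom)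

/-- The partial derivatives of a germ: `∂ 0 f = f_x` and `∂ 1 f = f_y`. -/
def partialDeriv (i : Fin 2) (f : O2) : O2 :=
  ⟨MvPowerSeries.pderiv ℂ i f.1, IsConvergent.pderiv f.2 i⟩

/-- The Jacobian ideal `j(f) = ⟨f_x, f_y⟩`. -/
def jacobianIdeal (f : O2) : Ideal O2 :=
  Ideal.span {partialDeriv 0 f, partialDeriv 1 f}

/-- The `k`-th Tjurina algebra `𝒪₂ / (𝔪^k j(f) + ⟨f⟩)`. -/
abbrev TjurinaAlgebra (k : ℕ) (f : O2) : Type :=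
  O2 ⧸ (maxIdeal ^ k * jacobianIdeal f ⊔ Ideal.span {f})

/-- The `k`-th Tjurina number `τ^k` of the curve germ `{f = 0}`. -/
def tjurinaNumber (k : ℕ) (f : O2) : ℕ :=
  Module.finrank ℂ (TjurinaAlgebra k f)

/-- The algebraic multiplicity `ν(f)` of a nonzero germ `f`: the least degree of a monomial
occurring in its power series. -/
def algMultiplicity (f : O2) : ℕ :=
  (MvPowerSeries.order f.1).toNat

/-- The germ at the origin of a polynomial. -/
def polyGerm (p : MvPolynomial (Fin 2) ℂ) : O2 :=
  ⟨(p : MvPowerSeries (Fin 2) ℂ), isConvergent_coe p⟩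

/-- `p` is weighted homogeneous of weight type `(w₁, w₂; 1)`: the weights are positive rationals and
`w₁ i + w₂ j = 1` for every monomial `x^i y^j` occurring in `p`. -/
def IsOfWeightType (w₁ w₂ : ℚ) (p : MvPolynomial (Fin 2) ℂ) : Prop :=
  0 < w₁ ∧ 0 < w₂ ∧ MvPolynomial.IsWeightedHomogeneous ![w₁, w₂] p 1

/-- The polynomial `x^a + y^b`. -/
def brieskorn (a b : ℕ) : MvPolynomial (Fin 2) ℂ :=
  MvPolynomial.X 0 ^ a + MvPolynomial.X 1 ^ b

/-- The quantity `ℓ^k(a, b)` for rational exponents `a ≤ b`. -/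
def ell (k : ℕ) (a b : ℚ) : ℚ :=
  if (k : ℚ) < a then (a - 1) * (b - 1) + k * (k + 3) / 2
  else (a - 1) * (b - 1) + k * (k + 3) / 2 - (k - a + 2) * (k - a + 1) / 2

end PlaneCurve

end

noncomputable section

namespace PlaneCurve

open MvPolynomial

/-! Clear denominators, so that `p i + q j = m` on the support of `f`, with `m / p = 1 / w₁` and `m
/ q = 1 / w₂`. Truncating at weight `s + 2 m` reduces `τ^k` to finite-dimensional linear algebra.
The truncated ideal is the image of `(α, β, γ) ↦ α f_x + β f_y + γ f` on polynomials bounded in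
weight, with `α`, `β` of order at least `k` (`map_weightTrunc_tjurinaIdeal`). The kernel always
contains the Koszul relations `u (f_y, -f_x, 0)` and the Euler relations `v (p x, q y, -m)`, where
order `k + 1 - n` for `u` and `k - 1` for `v` suffices if `f` has order at least `n`
(`map_relMap_le`).

Counting monomials, with `T j = j (j + 1) / 2`, gives `τ^k ≥ Δ(s) + 2 T(k) - T(k - 1) - T(k + 1 -
n)` for all large `s`, where `Δ` is `latticeDiff`. Averaged over shifts of `s`, `Δ` equals `(m / p -
1) (m / q - 1)` exactly, so some large `s` reaches at least this value and some at most. As `2 T(k)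
- T(k - 1) = k (k + 3) / 2`, this is `ℓ^k` when `n = 1 / w₁`, and it is at least `ℓ^k` when `n ≥ 1 /
w₁`.

For `x^a + y^b` the partial derivatives are coprime up to units, the relations above exhaust the
kernel (`gradDomain_inf_ker_le_brieskorn`), and equality follows. Finiteness in general comes from
the Nullstellensatz: a critical point of `f` other than the origin would make the closure of its
weighted `ℂ*`-orbit a double component of `f`. -/

theorem degree_fin_two (d : Fin 2 →₀ ℕ) : d.degree = d 0 + d 1 := by
  simp [Finsupp.degree_eq_sum]

/-! ### Polynomial germs and powers of the maximal ideal. -/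

/-- The inclusion of polynomials into germs, as an algebra homomorphism. -/
def polyGermHom : MvPolynomial (Fin 2) ℂ →ₐ[ℂ] O2 :=
  (coeToMvPowerSeries.algHom (R := ℂ) (σ := Fin 2) ℂ).codRestrict convergentSeries
    (fun p => by simpa using! isConvergent_coe p)

@[simp] theorem polyGermHom_apply (p : MvPolynomial (Fin 2) ℂ) : polyGermHom p = polyGerm p := by
  apply Subtype.ext
  simp [polyGermHom, polyGerm]

@[simp] theorem coe_polyGerm (p : MvPolynomial (Fin 2) ℂ) :
    (polyGerm p : MvPowerSeries (Fin 2) ℂ) = (p : MvPowerSeries (Fin 2) ℂ) := rfl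

theorem partialDeriv_polyGerm (i : Fin 2) (p : MvPolynomial (Fin 2) ℂ) :
    partialDeriv i (polyGerm p) = polyGerm (pderiv i p) :=
  Subtype.ext (MvPowerSeries.pderiv_coe p)

theorem mem_maxIdeal {f : O2} : f ∈ maxIdeal ↔ MvPowerSeries.constantCoeff f.1 = 0 := Iff.rfl

theorem polyGerm_X_mem_maxIdeal (i : Fin 2) : polyGerm (X i) ∈ maxIdeal := by
  simp [mem_maxIdeal]

theorem IsConvergent.of_norm_coeff_le_shift {f g : MvPowerSeries (Fin 2) ℂ} (hf : IsConvergent f)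
    (e : Fin 2 →₀ ℕ)
    (h : ∀ d, ‖MvPowerSeries.coeff d g‖ ≤ ‖MvPowerSeries.coeff (d + e) f‖) :
    IsConvergent g := by
  obtain ⟨r, hr, hf⟩ := hf
  have key := (hf.comp_injective (add_left_injective e)).mul_left ((r ^ e.degree)⁻¹)
  refine ⟨r, hr, Summable.of_nonneg_of_le (fun d => by positivity) (fun d => ?_) key⟩
  simp only [Function.comp]
  rw [map_add, pow_add]
  have : (r ^ e.degree)⁻¹ * (‖MvPowerSeries.coeff (d + e) f‖ * (r ^ d.degree * r ^ e.degree)) =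
      ‖MvPowerSeries.coeff (d + e) f‖ * r ^ d.degree := by
    field_simp
  rw [this]
  gcongr
  exact h d

theorem exists_eq_const_add_X_mul_add_X_mul (f : O2) :
    ∃ (c : ℂ) (g h : O2),
      f = polyGerm (C c) + polyGerm (X 0) * g + polyGerm (X 1) * h := by
  classical
  let g : MvPowerSeries (Fin 2) ℂ :=
    fun d => MvPowerSeries.coeff (d + Finsupp.single 0 1) f.1
  -- Monomials divisible by `x` are all assigned to `g`; restricting `h` to pure powers of `y`
  -- avoids counting them twice.
  let h : MvPowerSeries (Fin 2) ℂ :=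
    fun d => if d 0 = 0 then MvPowerSeries.coeff (d + Finsupp.single 1 1) f.1 else 0
  have hg : IsConvergent g := f.2.of_norm_coeff_le_shift (Finsupp.single 0 1) fun d => le_rfl
  have hh : IsConvergent h := f.2.of_norm_coeff_le_shift (Finsupp.single 1 1) fun d => by
    change ‖if d 0 = 0 then MvPowerSeries.coeff (d + Finsupp.single 1 1) f.1 else 0‖ ≤ _
    split_ifs <;> simp
  refine ⟨MvPowerSeries.coeff 0 f.1, ⟨g, hg⟩, ⟨h, hh⟩, Subtype.ext ?_⟩
  ext d
  simp only [Subalgebra.coe_add, Subalgebra.coe_mul, coe_polyGerm, coe_X, coe_C, map_add,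
    MvPowerSeries.X, MvPowerSeries.coeff_monomial_mul, one_mul]
  have hg' (d) : MvPowerSeries.coeff d g = MvPowerSeries.coeff (d + Finsupp.single 0 1) f.1 := rfl
  have hh' (d) : MvPowerSeries.coeff d h =
    if d 0 = 0 then MvPowerSeries.coeff (d + Finsupp.single 1 1) f.1 else 0 := rfl
  have hle (i : Fin 2) : Finsupp.single i 1 ≤ d ↔ d i ≠ 0 := by
    rw [Finsupp.single_le_iff]; omega
  simp only [hg', hh', hle, MvPowerSeries.coeff_C]
  by_cases h0 : d 0 = 0
  · by_cases h1 : d 1 = 0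
    · have : d = 0 := by
        ext i; fin_cases i <;> simp [h0, h1]
      simp [this]
    · have hd : d ≠ 0 := by rintro rfl; simp at h1
      have := tsub_add_cancel_of_le ((hle 1).2 h1)
      simp [h0, h1, hd, this]
  · have hd : d ≠ 0 := by rintro rfl; simp at h0
    have := tsub_add_cancel_of_le ((hle 0).2 h0)
    simp [h0, hd, this]

theorem maxIdeal_eq_sup :
    maxIdeal = Ideal.span {polyGerm (X 0)} ⊔ Ideal.span {polyGerm (X 1)} := by
  apply le_antisymm
  · intro f hf
    obtain ⟨c, g, h, rfl⟩ := exists_eq_const_add_X_mul_add_X_mul f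
    have hc : c = 0 := by simpa [mem_maxIdeal] using hf
    subst hc
    have h0 : polyGerm (C 0) = 0 := by rw [← polyGermHom_apply, map_zero, map_zero]
    rw [h0, zero_add]
    exact Submodule.add_mem_sup (Ideal.mul_mem_right _ _ (Ideal.mem_span_singleton_self _))
      (Ideal.mul_mem_right _ _ (Ideal.mem_span_singleton_self _))
  · simp [Ideal.span_le, polyGerm_X_mem_maxIdeal]

theorem le_order_of_mem_maxIdeal_pow {k : ℕ} {f : O2} (hf : f ∈ maxIdeal ^ k) :
    (k : ℕ∞) ≤ MvPowerSeries.order f.1 := by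
  induction k generalizing f with
  | zero => simp
  | succ k ih =>
    rw [pow_succ] at hf
    refine Submodule.mul_induction_on hf (fun a ha b hb => ?_) (fun a b ha hb => ?_)
    · have h1 : (1 : ℕ∞) ≤ MvPowerSeries.order b.1 :=
        MvPowerSeries.one_le_order_iff_constCoeff_eq_zero.2 hb
      calc ((k + 1 : ℕ) : ℕ∞) = k + 1 := by push_cast; rfl
        _ ≤ _ := add_le_add (ih ha) h1
        _ ≤ _ := MvPowerSeries.le_order_mul
    · exact le_trans (le_min ha hb) MvPowerSeries.min_order_le_add

theorem coeff_eq_zero_of_mem_maxIdeal_pow {k : ℕ} {f : O2} (hf : f ∈ maxIdeal ^ k)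
    {d : Fin 2 →₀ ℕ} (hd : d 0 + d 1 < k) : MvPowerSeries.coeff d f.1 = 0 := by
  apply MvPowerSeries.coeff_of_lt_order
  refine lt_of_lt_of_le ?_ (le_order_of_mem_maxIdeal_pow hf)
  rw [degree_fin_two]
  exact_mod_cast hd

theorem polyGerm_mem_maxIdeal_pow {k : ℕ} {P : MvPolynomial (Fin 2) ℂ}
    (hP : ∀ d, coeff d P ≠ 0 → k ≤ d 0 + d 1) : polyGerm P ∈ maxIdeal ^ k := by
  rw [← polyGermHom_apply, P.as_sum, map_sum]
  refine Ideal.sum_mem _ fun d hd => ?_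
  have hk := hP d (mem_support_iff.1 hd)
  rw [monomial_eq, map_mul, Finsupp.prod_fintype _ _ (fun i => pow_zero _), Fin.prod_univ_two,
    map_mul, map_pow, map_pow, polyGermHom_apply, polyGermHom_apply, polyGermHom_apply]
  refine Ideal.mul_mem_left _ _ (Ideal.pow_le_pow_right hk ?_)
  rw [pow_add]
  exact Ideal.mul_mem_mul (Ideal.pow_mem_pow (polyGerm_X_mem_maxIdeal 0) _)
    (Ideal.pow_mem_pow (polyGerm_X_mem_maxIdeal 1) _)

theorem mul_mem_restrictSupport {R S T : Set (Fin 2 →₀ ℕ)} {P Q : MvPolynomial (Fin 2) ℂ}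
    (hP : P ∈ restrictSupport ℂ R) (hQ : Q ∈ restrictSupport ℂ S)
    (h : ∀ d ∈ R, ∀ e ∈ S, d + e ∈ T) : P * Q ∈ restrictSupport ℂ T :=
  restrictSupport_mono ℂ (Set.add_subset_iff.2 h)
    (restrictSupport_add (R := ℂ) R S ▸ Submodule.mul_mem_mul hP hQ)

theorem exists_poly_sub_mem_maxIdeal_pow (M : ℕ) (f : O2) :
    ∃ P ∈ restrictSupport ℂ {d : Fin 2 →₀ ℕ | d 0 + d 1 < M}, f - polyGerm P ∈ maxIdeal ^ M := by
  induction M generalizing f with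
  | zero => exact ⟨0, zero_mem _, by simp⟩
  | succ M ih =>
    obtain ⟨c, g, h, rfl⟩ := exists_eq_const_add_X_mul_add_X_mul f
    obtain ⟨P, hP, hP'⟩ := ih g
    obtain ⟨Q, hQ, hQ'⟩ := ih h
    have hX (i : Fin 2) (P) (hP : P ∈ restrictSupport ℂ {d : Fin 2 →₀ ℕ | d 0 + d 1 < M}) :
        X i * P ∈ restrictSupport ℂ {d : Fin 2 →₀ ℕ | d 0 + d 1 < M + 1} := by
      refine mul_mem_restrictSupport (R := {Finsupp.single i 1}) ?_ hP ?_
      · rw [X, monomial_mem_restrictSupport]; simp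
      · rintro d rfl e he
        simp only [Set.mem_ofPred_eq, Finsupp.add_apply] at he ⊢
        fin_cases i <;> simp <;> omega
    refine ⟨C c + X 0 * P + X 1 * Q, add_mem (add_mem ?_ (hX 0 P hP)) (hX 1 Q hQ), ?_⟩
    · rw [C_apply, monomial_mem_restrictSupport]; simp
    · have : polyGerm (C c) + polyGerm (X 0) * g + polyGerm (X 1) * h -
          polyGerm (C c + X 0 * P + X 1 * Q) =
          (g - polyGerm P) * polyGerm (X 0) + (h - polyGerm Q) * polyGerm (X 1) := by
        simp only [← polyGermHom_apply, map_add, map_mul]; ring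
      rw [this, pow_succ]
      exact add_mem (Ideal.mul_mem_mul hP' (polyGerm_X_mem_maxIdeal 0))
        (Ideal.mul_mem_mul hQ' (polyGerm_X_mem_maxIdeal 1))

/-- Modulo `𝔪^k` the germ is a polynomial of degree below `k`, whose coefficients are those of the
germ and hence vanish. -/
theorem mem_maxIdeal_pow_of_coeff {k : ℕ} {f : O2}
    (hf : ∀ d, d 0 + d 1 < k → MvPowerSeries.coeff d f.1 = 0) : f ∈ maxIdeal ^ k := by
  obtain ⟨P, hP, h⟩ := exists_poly_sub_mem_maxIdeal_pow k f
  have hP0 : P = 0 := by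
    ext d
    rw [coeff_zero]
    by_cases hd : d 0 + d 1 < k
    · have h1 := coeff_eq_zero_of_mem_maxIdeal_pow h hd
      simpa [hf d hd] using h1
    · by_contra h0
      exact hd (hP (mem_support_iff.2 h0))
  have h0 : polyGerm 0 = 0 := by rw [← polyGermHom_apply, map_zero]
  simpa [hP0, h0] using h

theorem finite_setOf_weight_lt {p q : ℕ} (hp : 0 < p) (hq : 0 < q) (s : ℕ) :
    {d : Fin 2 →₀ ℕ | p * d 0 + q * d 1 < s}.Finite := by
  refine (Set.finite_Iic (Finsupp.single 0 s + Finsupp.single 1 s : Fin 2 →₀ ℕ)).subset ?_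
  intro d hd i
  simp only [Set.mem_ofPred_eq] at hd
  fin_cases i <;> simp <;> nlinarith

theorem finite_quotient_of_maxIdeal_pow_le {I : Ideal O2} {M : ℕ} (h : maxIdeal ^ M ≤ I) :
    Module.Finite ℂ (O2 ⧸ I) := by
  let V := restrictSupport ℂ {d : Fin 2 →₀ ℕ | d 0 + d 1 < M}
  have hfin : {d : Fin 2 →₀ ℕ | d 0 + d 1 < M}.Finite := by
    simpa using finite_setOf_weight_lt one_pos one_pos M
  have : Finite {d : Fin 2 →₀ ℕ | d 0 + d 1 < M} := hfin
  have : Module.Finite ℂ V := Module.Finite.of_basis (basisRestrictSupport ℂ _)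
  let T : V →ₗ[ℂ] O2 ⧸ I :=
    (Ideal.Quotient.mkₐ ℂ I).toLinearMap ∘ₗ polyGermHom.toLinearMap ∘ₗ V.subtype
  refine Module.Finite.of_surjective T fun y => ?_
  obtain ⟨f, rfl⟩ := Ideal.Quotient.mk_surjective y
  obtain ⟨P, hP, hP'⟩ := exists_poly_sub_mem_maxIdeal_pow M f
  refine ⟨⟨P, hP⟩, ?_⟩
  simp only [T, LinearMap.comp_apply, Submodule.subtype_apply, AlgHom.toLinearMap_apply,
    polyGermHom_apply, Ideal.Quotient.mkₐ_eq_mk]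
  exact (Ideal.Quotient.eq.2 (h hP')).symm

/-! ### Lattice points in weighted triangles, and spaces of polynomials. -/

section LatticeCount

open Finset

/-- The number of `(i, j) ∈ ℕ²` with `p i + q j < s`, for positive `p` and `q`. -/
def latticeCount (p q s : ℕ) : ℕ :=
  #{x ∈ range s ×ˢ range s | p * x.1 + q * x.2 < s}

theorem latticeCount_eq_sum {p q : ℕ} (hp : 0 < p) (hq : 0 < q) {s M : ℕ} (hM : s ≤ M) :
    latticeCount p q s = ∑ i ∈ range M, ∑ j ∈ range M, if p * i + q * j < s then 1 else 0 := by
  rw [← sum_product', latticeCount, card_eq_sum_ones, sum_filter]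
  apply sum_subset
  · exact product_subset_product (range_mono hM) (range_mono hM)
  · intro x _ hx
    rw [if_neg]
    contrapose! hx
    simp only [mem_product, mem_range]
    constructor <;> nlinarith

theorem latticeCount_one_one (s : ℕ) : latticeCount 1 1 s * 2 = s * (s + 1) := by
  rw [latticeCount_eq_sum one_pos one_pos le_rfl]
  have h (i) (hi : i ∈ range s) :
      (∑ j ∈ range s, if 1 * i + 1 * j < s then 1 else 0) = s - 1 - i + 1 := by
    rw [← sum_filter, sum_const, smul_eq_mul, mul_one]
    have : (range s).filter (fun j => 1 * i + 1 * j < s) = range (s - i) := by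
      ext j; simp only [mem_filter, mem_range]; omega
    rw [this, card_range]
    simp only [mem_range] at hi
    omega
  rw [sum_congr rfl h, sum_range_reflect (fun i => i + 1) s, sum_add_distrib, add_mul,
    sum_range_id_mul_two]
  cases s <;> simp; ring

theorem sum_range_mul_eq {M : Type*} [AddCommMonoid M] (g : ℕ → M) (p n : ℕ) :
    ∑ x ∈ range (p * n), g x = ∑ i ∈ range n, ∑ r ∈ range p, g (p * i + r) := by
  induction n with
  | zero => simp
  | succ n ih => rw [mul_add, mul_one, sum_range_add, ih, sum_range_succ]

/-- Division with remainder, `P = p i + r` and `Q = q j + r'`, sorts the points with `P + Q < s` by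
residue pair `(r, r')`. This averages away the quasi-polynomial behaviour of `latticeCount p q`. -/
theorem sum_latticeCount_sub {p q : ℕ} (hp : 0 < p) (hq : 0 < q) (s : ℕ) :
    ∑ x ∈ range p ×ˢ range q, latticeCount p q (s - (x.1 + x.2)) = latticeCount 1 1 s := by
  have h1 : latticeCount 1 1 s = ∑ P ∈ range (p * s), ∑ Q ∈ range (q * s),
      if P + Q < s then 1 else 0 := by
    rw [latticeCount_eq_sum one_pos one_pos (M := p * s + q * s) (by nlinarith)]
    symm
    rw [← sum_product', ← sum_product']
    simp only [one_mul]
    apply sum_subset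
    · exact product_subset_product (range_mono (by omega)) (range_mono (by omega))
    · intro x _ hx
      rw [if_neg]
      contrapose! hx
      simp only [mem_product, mem_range]
      constructor <;> nlinarith
  rw [h1, sum_range_mul_eq]
  simp_rw [sum_range_mul_eq _ q]
  have h2 (x : ℕ × ℕ) : latticeCount p q (s - (x.1 + x.2)) =
      ∑ i ∈ range s, ∑ j ∈ range s, if p * i + x.1 + (q * j + x.2) < s then 1 else 0 := by
    rw [latticeCount_eq_sum hp hq (Nat.sub_le s (x.1 + x.2))]
    refine sum_congr rfl fun i _ => sum_congr rfl fun j _ => if_congr ?_ rfl rfl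
    omega
  simp_rw [h2]
  rw [sum_product]
  calc _ = _ := sum_congr rfl fun _ _ => sum_comm
    _ = _ := sum_comm
    _ = _ := sum_congr rfl fun _ _ => sum_congr rfl fun _ _ => sum_comm

/-- The second difference of `latticeCount p q` with steps `m - p` and `m - q`. -/
def latticeDiff (p q m s : ℕ) : ℤ :=
  latticeCount p q (s + 2 * m) - latticeCount p q (s + m + p) - latticeCount p q (s + m + q)
    + latticeCount p q (s + p + q)

/-- After averaging, the count is the quadratic `s (s + 1) / 2`, whose second difference is the
product of the steps. The bound on `s` keeps the subtractions from truncating. -/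
theorem sum_latticeDiff {p q : ℕ} (hp : 0 < p) (hq : 0 < q) (m : ℕ) {s : ℕ} (hs : p + q ≤ s) :
    ∑ x ∈ range p ×ˢ range q, latticeDiff p q m (s - (x.1 + x.2)) =
      ((m : ℤ) - p) * (m - q) := by
  have key (c : ℕ) : ∑ x ∈ range p ×ˢ range q,
      (latticeCount p q (s - (x.1 + x.2) + c) : ℤ) = latticeCount 1 1 (s + c) := by
    rw [← sum_latticeCount_sub hp hq (s + c)]
    push_cast
    refine sum_congr rfl fun x hx => ?_
    simp only [mem_product, mem_range] at hx
    congr 2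
    omega
  have tri (c : ℕ) : (latticeCount 1 1 (s + c) : ℤ) * 2 = (s + c) * (s + c + 1) := by
    exact_mod_cast latticeCount_one_one (s + c)
  simp only [latticeDiff, add_assoc, sum_add_distrib, sum_sub_distrib, key]
  have h1 := tri (2 * m)
  have h2 := tri (m + p)
  have h3 := tri (m + q)
  have h4 := tri (p + q)
  push_cast at h1 h2 h3 h4
  linarith

/-- The maximum over the `p q` shifts is at least the average. -/
theorem exists_le_latticeDiff {p q : ℕ} (hp : 0 < p) (hq : 0 < q) (m s₀ : ℕ) :
    ∃ s, s₀ ≤ s ∧ ((m : ℤ) - p) * (m - q) ≤ p * q * latticeDiff p q m s := by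
  have hne : (range p ×ˢ range q).Nonempty := ⟨(0, 0), by simp [hp, hq]⟩
  have hsum := sum_latticeDiff hp hq m (s := s₀ + p + q) (by omega)
  obtain ⟨x, hx, h⟩ := exists_max_image _ (fun x => latticeDiff p q m (s₀ + p + q - (x.1 + x.2))) hne
  refine ⟨s₀ + p + q - (x.1 + x.2), ?_, ?_⟩
  rotate_left
  · rw [← hsum]
    refine (sum_le_card_nsmul _ _ _ h).trans (le_of_eq ?_)
    simp
  · simp only [mem_product, mem_range] at hx
    omega

theorem exists_latticeDiff_le {p q : ℕ} (hp : 0 < p) (hq : 0 < q) (m s₀ : ℕ) :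
    ∃ s, s₀ ≤ s ∧ p * q * latticeDiff p q m s ≤ ((m : ℤ) - p) * (m - q) := by
  have hne : (range p ×ˢ range q).Nonempty := ⟨(0, 0), by simp [hp, hq]⟩
  have hsum := sum_latticeDiff hp hq m (s := s₀ + p + q) (by omega)
  obtain ⟨x, hx, h⟩ := exists_min_image _ (fun x => latticeDiff p q m (s₀ + p + q - (x.1 + x.2))) hne
  refine ⟨s₀ + p + q - (x.1 + x.2), ?_, ?_⟩
  rotate_left
  · rw [← hsum]
    refine le_trans (le_of_eq ?_) (card_nsmul_le_sum _ _ _ h)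
    simp
  · simp only [mem_product, mem_range] at hx
    omega

/-- The exponents `(i, j)` with `p i + q j < s` and `k ≤ i + j`. -/
def region (p q s k : ℕ) : Set (Fin 2 →₀ ℕ) :=
  {d | p * d 0 + q * d 1 < s ∧ k ≤ d 0 + d 1}

/-- The polynomials with exponents in `region p q s k`. -/
abbrev regionPoly (p q s k : ℕ) : Submodule ℂ (MvPolynomial (Fin 2) ℂ) :=
  restrictSupport ℂ (region p q s k)

theorem region_finite {p q : ℕ} (hp : 0 < p) (hq : 0 < q) (s k : ℕ) : (region p q s k).Finite :=
  (finite_setOf_weight_lt hp hq s).subset fun _ hd => hd.1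

theorem finite_regionPoly {p q : ℕ} (hp : 0 < p) (hq : 0 < q) (s k : ℕ) :
    Module.Finite ℂ (regionPoly p q s k) :=
  have : Finite (region p q s k) := region_finite hp hq s k
  Module.Finite.of_basis (basisRestrictSupport ℂ _)

/-- The bound on `s` puts every monomial of degree below `k` under the weight cutoff, so the order
condition removes exactly `latticeCount 1 1 k` of them. -/
theorem finrank_regionPoly {p q : ℕ} (hp : 0 < p) (hq : 0 < q) {s k : ℕ}
    (hs : (p + q) * k ≤ s) :
    Module.finrank ℂ (regionPoly p q s k) + latticeCount 1 1 k = latticeCount p q s := by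
  rw [Module.finrank_eq_nat_card_basis (basisRestrictSupport ℂ _), Nat.card_coe_set_eq]
  let e : ℕ × ℕ → (Fin 2 →₀ ℕ) := fun x => Finsupp.single 0 x.1 + Finsupp.single 1 x.2
  have he0 (x) : e x 0 = x.1 := by simp [e]
  have he1 (x) : e x 1 = x.2 := by simp [e]
  have he : Function.Injective e := fun x y h => by
    ext
    · rw [← he0, ← he0, h]
    · rw [← he1, ← he1, h]
  have himg : region p q s k =
      e '' ({x ∈ range s ×ˢ range s | p * x.1 + q * x.2 < s ∧ k ≤ x.1 + x.2} : Finset _) := by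
    ext d
    constructor
    · rintro ⟨h1, h2⟩
      refine ⟨(d 0, d 1), ?_, ?_⟩
      · simp only [coe_filter, mem_product, mem_range, Set.mem_ofPred_eq]
        refine ⟨⟨?_, ?_⟩, h1, h2⟩ <;> nlinarith
      · ext i; fin_cases i
        · exact he0 _
        · exact he1 _
    · rintro ⟨x, hx, rfl⟩
      simp only [coe_filter, mem_product, mem_range, Set.mem_ofPred_eq] at hx
      simp only [region, Set.mem_ofPred_eq, he0, he1]
      exact hx.2
  rw [himg, Set.ncard_image_of_injective _ he, Set.ncard_coe_finset, latticeCount, latticeCount,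
    ← card_filter_add_card_filter_not (s := {x ∈ range s ×ˢ range s | p * x.1 + q * x.2 < s})
      (fun x => k ≤ x.1 + x.2), filter_filter, filter_filter]
  congr 2
  ext x
  simp only [mem_filter, mem_product, mem_range, not_le, one_mul]
  constructor
  · rintro ⟨-, h⟩
    have : p * x.1 + q * x.2 < s := by nlinarith
    refine ⟨⟨?_, ?_⟩, this, h⟩ <;> nlinarith
  · rintro ⟨-, -, h⟩
    omega

end LatticeCount

/-! ### Dimensions of images and quotients. -/

section LinearAlgebra
variable {K E F : Type*} [Field K] [AddCommGroup E] [Module K E] [AddCommGroup F] [Module K F]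

theorem finrank_map_add_finrank_inf_ker (T : E →ₗ[K] F) (U : Submodule K E) [Module.Finite K U] :
    Module.finrank K (U.map T) + Module.finrank K (U ⊓ LinearMap.ker T : Submodule K E) =
      Module.finrank K U := by
  have h := (T.domRestrict U).finrank_range_add_finrank_ker
  rw [LinearMap.range_domRestrict, LinearMap.ker_domRestrict] at h
  rw [← h, ← Submodule.finrank_map_subtype_eq U, Submodule.map_comap_subtype]

/-- The product of two submodules, as a submodule, is the product of the two as modules. -/
def submoduleProdEquiv (A : Submodule K E) (B : Submodule K F) : A.prod B ≃ₗ[K] A × B where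
  toFun x := (⟨x.1.1, x.2.1⟩, ⟨x.1.2, x.2.2⟩)
  invFun y := ⟨(y.1.1, y.2.1), y.1.2, y.2.2⟩
  map_add' _ _ := rfl
  map_smul' _ _ := rfl
  left_inv _ := rfl
  right_inv _ := rfl

instance finite_submodule_prod (A : Submodule K E) (B : Submodule K F) [Module.Finite K A]
    [Module.Finite K B] : Module.Finite K (A.prod B) :=
  Module.Finite.equiv (submoduleProdEquiv A B).symm

theorem finrank_submodule_prod (A : Submodule K E) (B : Submodule K F) [Module.Finite K A]
    [Module.Finite K B] :
    Module.finrank K (A.prod B) = Module.finrank K A + Module.finrank K B := by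
  rw [← Module.finrank_prod]
  exact LinearEquiv.finrank_eq (submoduleProdEquiv A B)

theorem finrank_range_le_finrank_quotient_add (T : E →ₗ[K] F) (I : Submodule K E)
    [Module.Finite K (E ⧸ I)] [Module.Finite K (LinearMap.range T)] :
    Module.finrank K (LinearMap.range T) ≤
      Module.finrank K (E ⧸ I) + Module.finrank K (I.map T) := by
  obtain ⟨Q, hQ⟩ := I.exists_isCompl
  let e := I.quotientEquivOfIsCompl Q hQ
  have : Module.Finite K Q := Module.Finite.equiv e
  have : Module.Finite K (I.map T) :=
    Submodule.finiteDimensional_of_le (LinearMap.map_le_range (f := T))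
  have h := Submodule.finrank_add_le_finrank_add_finrank (I.map T) (Q.map T)
  rw [← Submodule.map_sup, hQ.sup_eq_top, ← LinearMap.range_eq_map] at h
  have h2 := Submodule.finrank_map_le T Q
  rw [e.finrank_eq]
  omega

/-- A complement `Q` of `I` meets `ker T ≤ I` trivially, so it embeds under `T`, with image disjoint
from that of `I`. -/
theorem finrank_quotient_add_le_finrank_range (T : E →ₗ[K] F) (I : Submodule K E)
    [Module.Finite K (E ⧸ I)] [Module.Finite K (LinearMap.range T)] (hker : LinearMap.ker T ≤ I) :
    Module.finrank K (E ⧸ I) + Module.finrank K (I.map T) ≤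
      Module.finrank K (LinearMap.range T) := by
  obtain ⟨Q, hQ⟩ := I.exists_isCompl
  let e := I.quotientEquivOfIsCompl Q hQ
  have : Module.Finite K Q := Module.Finite.equiv e
  have : Module.Finite K (I.map T) :=
    Submodule.finiteDimensional_of_le (LinearMap.map_le_range (f := T))
  have h := Submodule.finrank_sup_add_finrank_inf_eq (I.map T) (Q.map T)
  have hinf : I.map T ⊓ Q.map T = ⊥ := by
    rw [eq_bot_iff]
    rintro _ ⟨⟨i, hi, rfl⟩, ⟨y, hy, hyi⟩⟩
    have h1 : y - i ∈ I := hker (by simp [hyi])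
    have h2 : y ∈ I := by simpa using add_mem h1 hi
    have h3 : y = 0 := by simpa using (hQ.disjoint.le_bot ⟨h2, hy⟩ : y ∈ (⊥ : Submodule K E))
    simp [← hyi, h3]
  have hQT := finrank_map_add_finrank_inf_ker T Q
  have hbot : Q ⊓ LinearMap.ker T = ⊥ :=
    eq_bot_iff.2 fun y hy => hQ.disjoint.le_bot ⟨hker hy.2, hy.1⟩
  rw [← Submodule.map_sup, hQ.sup_eq_top, ← LinearMap.range_eq_map, hinf, finrank_bot] at h
  rw [hbot, finrank_bot] at hQT
  rw [e.finrank_eq]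
  omega

end LinearAlgebra

/-! ### Truncation by weight. -/

theorem mem_restrictSupport_of_coeff {R : Set (Fin 2 →₀ ℕ)} {P : MvPolynomial (Fin 2) ℂ}
    (h : ∀ d, coeff d P ≠ 0 → d ∈ R) : P ∈ restrictSupport ℂ R :=
  fun d hd => h d (mem_support_iff.1 hd)

theorem mem_of_coeff_ne_zero {R : Set (Fin 2 →₀ ℕ)} {P : MvPolynomial (Fin 2) ℂ}
    (hP : P ∈ restrictSupport ℂ R) {d : Fin 2 →₀ ℕ} (hd : coeff d P ≠ 0) : d ∈ R :=
  hP (mem_support_iff.2 hd)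

theorem eq_single_of_coeff_X_ne_zero {i : Fin 2} {e : Fin 2 →₀ ℕ}
    (he : coeff e (X i : MvPolynomial (Fin 2) ℂ) ≠ 0) : e = Finsupp.single i 1 := by
  classical
  rw [coeff_X] at he
  by_contra h
  exact he (if_neg fun h' => h h'.symm)

/-- Truncation of power series to the exponents of `region p q s 0`. -/
def weightTrunc {p q : ℕ} (hp : 0 < p) (hq : 0 < q) (s : ℕ) : O2 →ₗ[ℂ] MvPolynomial (Fin 2) ℂ :=
  MvPowerSeries.truncFinset ℂ (region_finite hp hq s 0).toFinset ∘ₗ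
    convergentSeries.val.toLinearMap

theorem coeff_weightTrunc {p q : ℕ} (hp : 0 < p) (hq : 0 < q) (s : ℕ) (g : O2)
    (d : Fin 2 →₀ ℕ) :
    coeff d (weightTrunc hp hq s g) =
      if p * d 0 + q * d 1 < s then MvPowerSeries.coeff d g.1 else 0 := by
  classical
  simp [weightTrunc, MvPowerSeries.coeff_truncFinset, region]

theorem weightTrunc_mem {p q : ℕ} (hp : 0 < p) (hq : 0 < q) {s k : ℕ} {g : O2}
    (hg : g ∈ maxIdeal ^ k) : weightTrunc hp hq s g ∈ regionPoly p q s k := by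
  refine mem_restrictSupport_of_coeff fun d hd => ?_
  rw [coeff_weightTrunc] at hd
  split_ifs at hd with h
  · refine ⟨h, ?_⟩
    contrapose! hd
    exact coeff_eq_zero_of_mem_maxIdeal_pow hg hd
  · exact absurd rfl hd

theorem weightTrunc_polyGerm {p q : ℕ} (hp : 0 < p) (hq : 0 < q) {s k : ℕ}
    {P : MvPolynomial (Fin 2) ℂ} (hP : P ∈ regionPoly p q s k) :
    weightTrunc hp hq s (polyGerm P) = P := by
  ext d
  rw [coeff_weightTrunc]
  split_ifs with h
  · simp
  · symm
    by_contra h0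
    exact h (hP (mem_support_iff.2 h0)).1

theorem range_weightTrunc {p q : ℕ} (hp : 0 < p) (hq : 0 < q) (s : ℕ) :
    LinearMap.range (weightTrunc hp hq s) = regionPoly p q s 0 := by
  apply le_antisymm
  · rintro _ ⟨g, rfl⟩
    exact weightTrunc_mem hp hq (by simp)
  · intro P hP
    exact ⟨polyGerm P, weightTrunc_polyGerm hp hq hP⟩

/-- Multiplication by a weighted homogeneous `g` of weight `b - a` shifts all weights equally, so it
commutes with truncation once the cutoff is shifted. The weight is given additively to avoid
subtraction in `ℕ`. -/
theorem weightTrunc_mul {p q : ℕ} (hp : 0 < p) (hq : 0 < q) {a b : ℕ}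
    {g : MvPolynomial (Fin 2) ℂ} (hg : ∀ d, coeff d g ≠ 0 → p * d 0 + q * d 1 + a = b)
    (s : ℕ) (h : O2) :
    weightTrunc hp hq (s + b) (h * polyGerm g) = weightTrunc hp hq (s + a) h * g := by
  classical
  ext d
  rw [coeff_weightTrunc, coeff_mul, Subalgebra.coe_mul, MvPowerSeries.coeff_mul]
  have hite (c : Prop) [Decidable c] (t : Finset ((Fin 2 →₀ ℕ) × (Fin 2 →₀ ℕ)))
      (F : (Fin 2 →₀ ℕ) × (Fin 2 →₀ ℕ) → ℂ) :
      (if c then ∑ x ∈ t, F x else 0) = ∑ x ∈ t, if c then F x else 0 := by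
    split_ifs <;> simp
  rw [hite]
  refine Finset.sum_congr rfl fun x hx => ?_
  rw [coe_polyGerm, coeff_coe, coeff_weightTrunc]
  by_cases h0 : coeff x.2 g = 0
  · simp [h0]
  have hx' := Finset.HasAntidiagonal.mem_antidiagonal.1 hx
  have h1 := hg _ h0
  have h2 : p * d 0 + q * d 1 < s + b ↔ p * x.1 0 + q * x.1 1 < s + a := by
    rw [← hx', Finsupp.add_apply, Finsupp.add_apply, mul_add, mul_add]
    omega
  simp only [h2, ite_mul, zero_mul]

/-- A monomial of degree below `M` has weight below `(p + q) M`, so the truncation sees it. -/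
theorem ker_weightTrunc_le {p q : ℕ} (hp : 0 < p) (hq : 0 < q) {s M : ℕ}
    (hs : (p + q) * M ≤ s) {g : O2} (hg : weightTrunc hp hq s g = 0) : g ∈ maxIdeal ^ M := by
  refine mem_maxIdeal_pow_of_coeff fun d hd => ?_
  have h := coeff_weightTrunc hp hq s g d
  rw [if_pos (by nlinarith), hg, coeff_zero] at h
  exact h.symm

/-! ### The Tjurina ideal, its generators and their relations. -/

/-- The ideal `𝔪^k j(f) + ⟨f⟩` that defines the `k`-th Tjurina algebra. -/
def tjurinaIdeal (k : ℕ) (f : O2) : Ideal O2 :=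
  maxIdeal ^ k * jacobianIdeal f ⊔ Ideal.span {f}

theorem mem_tjurinaIdeal {k : ℕ} {f : MvPolynomial (Fin 2) ℂ} {g : O2} :
    g ∈ tjurinaIdeal k (polyGerm f) ↔ ∃ α ∈ maxIdeal ^ k, ∃ β ∈ maxIdeal ^ k, ∃ γ : O2,
      g = α * polyGerm (pderiv 0 f) + β * polyGerm (pderiv 1 f) + γ * polyGerm f := by
  rw [tjurinaIdeal, jacobianIdeal, partialDeriv_polyGerm, partialDeriv_polyGerm, Ideal.span_insert,
    Ideal.mul_sup, Submodule.mem_sup]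
  simp only [Submodule.mem_sup, Ideal.mem_mul_span_singleton, Ideal.mem_span_singleton']
  constructor
  · rintro ⟨_, ⟨_, ⟨α, hα, rfl⟩, _, ⟨β, hβ, rfl⟩, rfl⟩, _, ⟨γ, rfl⟩, rfl⟩
    exact ⟨α, hα, β, hβ, γ, rfl⟩
  · rintro ⟨α, hα, β, hβ, γ, rfl⟩
    exact ⟨_, ⟨_, ⟨α, hα, rfl⟩, _, ⟨β, hβ, rfl⟩, rfl⟩, _, ⟨γ, rfl⟩, rfl⟩

/-- The map `(α, β, γ) ↦ α f_x + β f_y + γ f`. -/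
def gradMap (f : MvPolynomial (Fin 2) ℂ) :
    MvPolynomial (Fin 2) ℂ × MvPolynomial (Fin 2) ℂ × MvPolynomial (Fin 2) ℂ →ₗ[ℂ]
      MvPolynomial (Fin 2) ℂ where
  toFun x := x.1 * pderiv 0 f + x.2.1 * pderiv 1 f + x.2.2 * f
  map_add' x y := by simp only [Prod.fst_add, Prod.snd_add]; ring
  map_smul' c x := by simp [smul_add]

/-- The map `(u, v) ↦ u (f_y, -f_x, 0) + v (p x, q y, -m)`, which parametrizes the Koszul and
Euler relations of a weighted homogeneous polynomial `f`. -/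
def relMap (p q m : ℕ) (f : MvPolynomial (Fin 2) ℂ) :
    MvPolynomial (Fin 2) ℂ × MvPolynomial (Fin 2) ℂ →ₗ[ℂ]
      MvPolynomial (Fin 2) ℂ × MvPolynomial (Fin 2) ℂ × MvPolynomial (Fin 2) ℂ where
  toFun x := (x.1 * pderiv 1 f + (p : ℂ) • (x.2 * X 0),
    -(x.1 * pderiv 0 f) + (q : ℂ) • (x.2 * X 1), -((m : ℂ) • x.2))
  map_add' x y := by
    simp only [Prod.fst_add, Prod.snd_add, Prod.mk_add_mk, Prod.mk.injEq, add_mul, smul_add]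
    refine ⟨?_, ?_, ?_⟩ <;> abel
  map_smul' c x := by
    simp only [Prod.smul_fst, Prod.smul_snd, Prod.smul_mk, smul_mul_assoc, smul_add,
      smul_neg, smul_comm c, RingHom.id_apply]

section Weighted
variable {p q m n : ℕ} {f : MvPolynomial (Fin 2) ℂ}

theorem coeff_pderiv_ne_zero {i : Fin 2} {d : Fin 2 →₀ ℕ} (h : coeff d (pderiv i f) ≠ 0) :
    coeff (d + Finsupp.single i 1) f ≠ 0 := by
  rw [coeff_pderiv] at h
  exact left_ne_zero_of_mul h

theorem weight_pderiv_zero (hf : ∀ d, coeff d f ≠ 0 → p * d 0 + q * d 1 = m) (d : Fin 2 →₀ ℕ)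
    (hd : coeff d (pderiv 0 f) ≠ 0) : p * d 0 + q * d 1 + p = m := by
  have := hf _ (coeff_pderiv_ne_zero hd)
  simp at this
  linarith

theorem weight_pderiv_one (hf : ∀ d, coeff d f ≠ 0 → p * d 0 + q * d 1 = m) (d : Fin 2 →₀ ℕ)
    (hd : coeff d (pderiv 1 f) ≠ 0) : p * d 0 + q * d 1 + q = m := by
  have := hf _ (coeff_pderiv_ne_zero hd)
  simp at this
  linarith

theorem le_degree_pderiv (hn : ∀ d, coeff d f ≠ 0 → n ≤ d 0 + d 1) (i : Fin 2) (d : Fin 2 →₀ ℕ)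
    (hd : coeff d (pderiv i f) ≠ 0) : n ≤ d 0 + d 1 + 1 := by
  have := hn _ (coeff_pderiv_ne_zero hd)
  fin_cases i <;> simp at this <;> linarith

theorem weighted_euler (hf : ∀ d, coeff d f ≠ 0 → p * d 0 + q * d 1 = m) :
    (p : ℂ) • (X 0 * pderiv 0 f) + (q : ℂ) • (X 1 * pderiv 1 f) = (m : ℂ) • f := by
  have h : IsWeightedHomogeneous ![p, q] f m := by
    intro d hd
    rw [Finsupp.weight_apply, Finsupp.sum_fintype _ _ (by simp), Fin.sum_univ_two, ← hf d hd]
    simp [mul_comm]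
  have := h.sum_weight_X_mul_pderiv
  rw [Fin.sum_univ_two] at this
  simpa [Nat.cast_smul_eq_nsmul] using this

/-- The source of `gradMap` for the truncation of `tjurinaIdeal k f` at weight `s + 2 m`. -/
abbrev gradDomain (p q m k s : ℕ) :
    Submodule ℂ (MvPolynomial (Fin 2) ℂ × MvPolynomial (Fin 2) ℂ × MvPolynomial (Fin 2) ℂ) :=
  (regionPoly p q (s + m + p) k).prod
    ((regionPoly p q (s + m + q) k).prod (regionPoly p q (s + m) 0))

/-- The pairs `(u, v)` that `relMap` sends to `gradDomain`. -/
abbrev relDomain (p q m n k s : ℕ) :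
    Submodule ℂ (MvPolynomial (Fin 2) ℂ × MvPolynomial (Fin 2) ℂ) :=
  (regionPoly p q (s + p + q) (k + 1 - n)).prod (regionPoly p q (s + m) (k - 1))

theorem map_weightTrunc_tjurinaIdeal (hp : 0 < p) (hq : 0 < q)
    (hf : ∀ d, coeff d f ≠ 0 → p * d 0 + q * d 1 = m) (k s : ℕ) :
    ((tjurinaIdeal k (polyGerm f)).restrictScalars ℂ).map (weightTrunc hp hq (s + 2 * m)) =
      (gradDomain p q m k s).map (gradMap f) := by
  have hs : s + 2 * m = s + m + m := by ring
  have hT (α β γ : O2) : weightTrunc hp hq (s + 2 * m)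
      (α * polyGerm (pderiv 0 f) + β * polyGerm (pderiv 1 f) + γ * polyGerm f) =
      gradMap f (weightTrunc hp hq (s + m + p) α, weightTrunc hp hq (s + m + q) β,
        weightTrunc hp hq (s + m) γ) := by
    rw [hs, map_add, map_add, weightTrunc_mul hp hq (weight_pderiv_zero hf),
      weightTrunc_mul hp hq (weight_pderiv_one hf), weightTrunc_mul hp hq (a := 0) (by simpa using hf)]
    rfl
  apply le_antisymm
  · rintro _ ⟨g, hg, rfl⟩
    obtain ⟨α, hα, β, hβ, γ, rfl⟩ := mem_tjurinaIdeal.1 hg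
    exact ⟨_, ⟨weightTrunc_mem hp hq hα, weightTrunc_mem hp hq hβ,
      weightTrunc_mem hp hq (k := 0) (by simp)⟩, (hT α β γ).symm⟩
  · rintro _ ⟨⟨α, β, γ⟩, ⟨hα, hβ, hγ⟩, rfl⟩
    refine ⟨polyGerm α * polyGerm (pderiv 0 f) + polyGerm β * polyGerm (pderiv 1 f) +
      polyGerm γ * polyGerm f, mem_tjurinaIdeal.2 ⟨_, polyGerm_mem_maxIdeal_pow ?_, _,
        polyGerm_mem_maxIdeal_pow ?_, _, rfl⟩, ?_⟩
    · exact fun d hd => (hα (mem_support_iff.2 hd)).2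
    · exact fun d hd => (hβ (mem_support_iff.2 hd)).2
    · rw [hT, weightTrunc_polyGerm hp hq hα, weightTrunc_polyGerm hp hq hβ,
        weightTrunc_polyGerm hp hq hγ]

theorem mul_mem_regionPoly {s k s' k' : ℕ} {P Q : MvPolynomial (Fin 2) ℂ}
    (hP : P ∈ regionPoly p q s k)
    (hQ : ∀ e, coeff e Q ≠ 0 → p * e 0 + q * e 1 + s ≤ s' ∧ k' ≤ k + (e 0 + e 1)) :
    P * Q ∈ regionPoly p q s' k' := by
  refine mul_mem_restrictSupport hP (mem_restrictSupport_of_coeff hQ) ?_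
  rintro d ⟨hd, hd'⟩ e ⟨he, he'⟩
  refine ⟨?_, ?_⟩
  · simp only [Finsupp.add_apply]; linarith
  · simp only [Finsupp.add_apply]; linarith

/-- The partial derivatives have order at least `n - 1` and the variables have order 1, which
explains the order bounds in `relDomain`. The weight cutoffs match because `f_x` and `f_y` have
weights `m - p` and `m - q`. -/
theorem map_relMap_le (hf : ∀ d, coeff d f ≠ 0 → p * d 0 + q * d 1 = m)
    (hn : ∀ d, coeff d f ≠ 0 → n ≤ d 0 + d 1) (k s : ℕ) :
    (relDomain p q m n k s).map (relMap p q m f) ≤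
      gradDomain p q m k s ⊓ LinearMap.ker (gradMap f) := by
  rintro _ ⟨⟨u, v⟩, ⟨hu, hv⟩, rfl⟩
  refine Submodule.mem_inf.2 ⟨Submodule.mem_prod.2 ⟨add_mem ?_ (Submodule.smul_mem _ _ ?_),
    Submodule.mem_prod.2 ⟨add_mem (neg_mem ?_) (Submodule.smul_mem _ _ ?_),
      neg_mem (Submodule.smul_mem _ _ ?_)⟩⟩, LinearMap.mem_ker.2 ?_⟩
  · refine mul_mem_regionPoly hu fun e he => ?_
    have h1 := weight_pderiv_one hf e he
    have h2 := le_degree_pderiv hn 1 e he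
    omega
  · refine mul_mem_regionPoly hv fun e he => ?_
    rw [eq_single_of_coeff_X_ne_zero he]
    simp; omega
  · refine mul_mem_regionPoly hu fun e he => ?_
    have h1 := weight_pderiv_zero hf e he
    have h2 := le_degree_pderiv hn 0 e he
    omega
  · refine mul_mem_regionPoly hv fun e he => ?_
    rw [eq_single_of_coeff_X_ne_zero he]
    simp; omega
  · have hsub : region p q (s + m) (k - 1) ⊆ region p q (s + m) 0 :=
      fun d hd => ⟨hd.1, Nat.zero_le _⟩
    exact restrictSupport_mono ℂ hsub hv
  · have h := weighted_euler hf
    simp only [gradMap, relMap, LinearMap.coe_mk, AddHom.coe_mk,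
      smul_eq_C_mul] at h ⊢
    linear_combination v * h

/-- The last component gives `v = 0`. Then `u ≠ 0` would force both partial derivatives, hence `f`
by Euler's formula, to vanish. -/
theorem relMap_injective (hf : ∀ d, coeff d f ≠ 0 → p * d 0 + q * d 1 = m) (hm : 0 < m)
    (hf0 : f ≠ 0) : Function.Injective (relMap p q m f) := by
  rw [injective_iff_map_eq_zero]
  rintro ⟨u, v⟩ h
  have hm' : (m : ℂ) ≠ 0 := by exact_mod_cast hm.ne'
  simp only [relMap, LinearMap.coe_mk, AddHom.coe_mk, Prod.mk_eq_zero, neg_eq_zero,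
    smul_eq_zero, hm', false_or] at h
  obtain ⟨h1, h2, rfl⟩ := h
  simp only [zero_mul, smul_zero, add_zero, mul_eq_zero, neg_eq_zero] at h1 h2
  by_contra hu
  have hu : u ≠ 0 := by simpa using hu
  have h := weighted_euler hf
  rw [h1.resolve_left hu, h2.resolve_left hu] at h
  simp only [mul_zero, smul_zero, add_zero] at h
  exact (smul_ne_zero hm' hf0) h.symm

theorem finite_gradDomain (hp : 0 < p) (hq : 0 < q) (m k s : ℕ) :
    Module.Finite ℂ (gradDomain p q m k s) := by
  have h (s k) := finite_regionPoly hp hq s k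
  have := h (s + m + p) k
  have := h (s + m + q) k
  have := h (s + m) 0
  infer_instance

theorem finrank_gradDomain (hp : 0 < p) (hq : 0 < q) {m k s : ℕ} (hs : (p + q) * k ≤ s) :
    Module.finrank ℂ (gradDomain p q m k s) + 2 * latticeCount 1 1 k =
      latticeCount p q (s + m + p) + latticeCount p q (s + m + q) + latticeCount p q (s + m) := by
  have h (s k) := finite_regionPoly hp hq s k
  rw [finrank_submodule_prod, finrank_submodule_prod]
  have h1 := finrank_regionPoly hp hq (s := s + m + p) (k := k) (by omega)
  have h2 := finrank_regionPoly hp hq (s := s + m + q) (k := k) (by omega)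
  have h3 := finrank_regionPoly hp hq (s := s + m) (k := 0) (by omega)
  have h4 := latticeCount_one_one 0
  omega

theorem finrank_relDomain (hp : 0 < p) (hq : 0 < q) {m n k s : ℕ} (hs : (p + q) * (k + 1) ≤ s) :
    Module.finrank ℂ (relDomain p q m n k s) + latticeCount 1 1 (k + 1 - n) +
        latticeCount 1 1 (k - 1) =
      latticeCount p q (s + p + q) + latticeCount p q (s + m) := by
  have h (s k) := finite_regionPoly hp hq s k
  rw [finrank_submodule_prod]
  have h0 (j) (hj : j ≤ k + 1) : (p + q) * j ≤ s := (Nat.mul_le_mul_left _ hj).trans hs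
  have h1 := finrank_regionPoly hp hq (s := s + p + q) (k := k + 1 - n)
    (by have := h0 (k + 1 - n) (by omega); omega)
  have h2 := finrank_regionPoly hp hq (s := s + m) (k := k - 1)
    (by have := h0 (k - 1) (by omega); omega)
  omega

theorem finrank_regionPoly_zero (hp : 0 < p) (hq : 0 < q) (s : ℕ) :
    Module.finrank ℂ (regionPoly p q s 0) = latticeCount p q s := by
  have h := finrank_regionPoly hp hq (s := s) (k := 0) (by omega)
  have := latticeCount_one_one 0
  omega

/-- Rank-nullity for `gradMap`, with its kernel bounded below by the injective image of `relDomain`.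
The two terms `latticeCount p q (s + m)`, from `γ` and from `v`, cancel. -/
theorem latticeDiff_le_finrank (hp : 0 < p) (hq : 0 < q) (hm : 0 < m) (hf0 : f ≠ 0)
    (hf : ∀ d, coeff d f ≠ 0 → p * d 0 + q * d 1 = m)
    (hn : ∀ d, coeff d f ≠ 0 → n ≤ d 0 + d 1) {k s : ℕ} (hs : (p + q) * (k + 1) ≤ s)
    [hfin : Module.Finite ℂ (O2 ⧸ tjurinaIdeal k (polyGerm f))] :
    latticeDiff p q m s + 2 * latticeCount 1 1 k - latticeCount 1 1 (k - 1) -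
      latticeCount 1 1 (k + 1 - n) ≤
        (Module.finrank ℂ (O2 ⧸ tjurinaIdeal k (polyGerm f)) : ℤ) := by
  have : Module.Finite ℂ (O2 ⧸ (tjurinaIdeal k (polyGerm f)).restrictScalars ℂ) := hfin
  have := finite_gradDomain hp hq m k s
  have hR : Module.Finite ℂ (LinearMap.range (weightTrunc hp hq (s + 2 * m))) := by
    rw [range_weightTrunc]; exact finite_regionPoly hp hq _ _
  have h1 := finrank_range_le_finrank_quotient_add (weightTrunc hp hq (s + 2 * m))
    ((tjurinaIdeal k (polyGerm f)).restrictScalars ℂ)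
  rw [map_weightTrunc_tjurinaIdeal hp hq hf, range_weightTrunc, finrank_regionPoly_zero hp hq] at h1
  have h2 := finrank_map_add_finrank_inf_ker (gradMap f) (gradDomain p q m k s)
  have : Module.Finite ℂ (gradDomain p q m k s ⊓ LinearMap.ker (gradMap f) : Submodule ℂ _) :=
    Submodule.finiteDimensional_of_le inf_le_left
  have h3 := Submodule.finrank_mono (map_relMap_le hf hn k s)
  rw [(Submodule.equivMapOfInjective _ (relMap_injective hf hm hf0) _).symm.finrank_eq] at h3
  have h4 := finrank_gradDomain hp hq (m := m) (k := k) (s := s) (by nlinarith)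
  have h5 := finrank_relDomain hp hq (m := m) (n := n) hs
  have h6 : Module.finrank ℂ (O2 ⧸ tjurinaIdeal k (polyGerm f)) =
    Module.finrank ℂ (O2 ⧸ (tjurinaIdeal k (polyGerm f)).restrictScalars ℂ) := rfl
  rw [latticeDiff]
  omega

/-- The same count reversed: it needs the kernel to consist of Koszul and Euler relations, and `s`
so large that truncation forgets only elements of the ideal. -/
theorem finrank_le_latticeDiff (hp : 0 < p) (hq : 0 < q) (hm : 0 < m) (hf0 : f ≠ 0)
    (hf : ∀ d, coeff d f ≠ 0 → p * d 0 + q * d 1 = m) {k s M : ℕ}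
    (hs : (p + q) * (k + 1) ≤ s) (hM : (p + q) * M ≤ s)
    (hMI : maxIdeal ^ M ≤ tjurinaIdeal k (polyGerm f))
    (hker : gradDomain p q m k s ⊓ LinearMap.ker (gradMap f) ≤
      (relDomain p q m n k s).map (relMap p q m f)) :
    (Module.finrank ℂ (O2 ⧸ tjurinaIdeal k (polyGerm f)) : ℤ) ≤
      latticeDiff p q m s + 2 * latticeCount 1 1 k - latticeCount 1 1 (k - 1) -
        latticeCount 1 1 (k + 1 - n) := by
  have hfin : Module.Finite ℂ (O2 ⧸ tjurinaIdeal k (polyGerm f)) :=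
    finite_quotient_of_maxIdeal_pow_le hMI
  have : Module.Finite ℂ (O2 ⧸ (tjurinaIdeal k (polyGerm f)).restrictScalars ℂ) := hfin
  have := finite_gradDomain hp hq m k s
  have hR : Module.Finite ℂ (LinearMap.range (weightTrunc hp hq (s + 2 * m))) := by
    rw [range_weightTrunc]; exact finite_regionPoly hp hq _ _
  have h1 := finrank_quotient_add_le_finrank_range (weightTrunc hp hq (s + 2 * m))
    ((tjurinaIdeal k (polyGerm f)).restrictScalars ℂ)
    (fun g hg => hMI (ker_weightTrunc_le hp hq (by omega) hg))
  rw [map_weightTrunc_tjurinaIdeal hp hq hf, range_weightTrunc, finrank_regionPoly_zero hp hq] at h1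
  have h2 := finrank_map_add_finrank_inf_ker (gradMap f) (gradDomain p q m k s)
  have : Module.Finite ℂ (relDomain p q m n k s) := by
    have h (s k) := finite_regionPoly hp hq s k
    have := h (s + p + q) (k + 1 - n)
    have := h (s + m) (k - 1)
    infer_instance
  have h3 := Submodule.finrank_mono hker
  rw [(Submodule.equivMapOfInjective _ (relMap_injective hf hm hf0) _).symm.finrank_eq] at h3
  have h4 := finrank_gradDomain hp hq (m := m) (k := k) (s := s) (by nlinarith)
  have h5 := finrank_relDomain hp hq (m := m) (n := n) hs
  have h6 : Module.finrank ℂ (O2 ⧸ tjurinaIdeal k (polyGerm f)) =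
    Module.finrank ℂ (O2 ⧸ (tjurinaIdeal k (polyGerm f)).restrictScalars ℂ) := rfl
  rw [latticeDiff]
  omega

end Weighted

/-! ### Finiteness: reduced weighted homogeneous curves have isolated singularities. -/

theorem maxIdeal_pow_le_tjurinaIdeal {f : MvPolynomial (Fin 2) ℂ} {a b : ℕ}
    (h0 : X 0 ^ a ∈ Ideal.span {pderiv 0 f, pderiv 1 f})
    (h1 : X 1 ^ b ∈ Ideal.span {pderiv 0 f, pderiv 1 f}) (k : ℕ) :
    maxIdeal ^ (k + (a + b)) ≤ tjurinaIdeal k (polyGerm f) := by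
  have hmap : (Ideal.span {pderiv 0 f, pderiv 1 f}).map polyGermHom =
      jacobianIdeal (polyGerm f) := by
    rw [Ideal.map_span, Set.image_pair, polyGermHom_apply, polyGermHom_apply, jacobianIdeal,
      partialDeriv_polyGerm, partialDeriv_polyGerm]
  have h (i : Fin 2) (n : ℕ) (hi : X i ^ n ∈ Ideal.span {pderiv 0 f, pderiv 1 f}) :
      Ideal.span {polyGerm (X i)} ^ n ≤ jacobianIdeal (polyGerm f) := by
    rw [Ideal.span_singleton_pow, Ideal.span_singleton_le_iff_mem, ← polyGermHom_apply (X i),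
      ← map_pow, ← hmap]
    exact Ideal.mem_map_of_mem _ hi
  rw [pow_add]
  refine le_sup_of_le_left (Ideal.mul_mono le_rfl ?_)
  rw [maxIdeal_eq_sup]
  exact Ideal.sup_pow_add_le_pow_sup_pow.trans (sup_le (h 0 a h0) (h 1 b h1))

section Isolated
variable {p q m : ℕ} {f : MvPolynomial (Fin 2) ℂ}

/-- The polynomials all of whose monomials `x^i y^j` satisfy `p i + q j + l = w`. -/
abbrev weightPoly (p q l w : ℕ) : Submodule ℂ (MvPolynomial (Fin 2) ℂ) :=
  restrictSupport ℂ {d : Fin 2 →₀ ℕ | p * d 0 + q * d 1 + l = w}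

/-- A weighted homogeneous binomial (or monomial) `x^D - c x^{D'}` of weight `l`, where `x^D` and
`x^{D'}` are powers of the two variables. -/
structure IsOrbitCurve (p q l : ℕ) (D D' : Fin 2 →₀ ℕ) (c : ℂ) : Prop where
  weight_lead : p * D 0 + q * D 1 = l
  weight_tail : c = 0 ∨ p * D' 0 + q * D' 1 = l
  exists_index : ∃ a, 0 < D a ∧ D' a = 0
  tail_ne_zero : D' ≠ 0
  eq_of_not_le : ∀ d d' : Fin 2 →₀ ℕ, p * d 0 + q * d 1 = p * d' 0 + q * d' 1 →
    ¬ D ≤ d → ¬ D ≤ d' → d = d'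

/-- Division with remainder by the binomial: `x^D` is repeatedly replaced by `c x^{D'}`. -/
theorem IsOrbitCurve.weightPoly_le {l : ℕ} {D D' : Fin 2 →₀ ℕ} {c : ℂ}
    (h : IsOrbitCurve p q l D D' c) (w : ℕ) :
    weightPoly p q 0 w ≤
      (weightPoly p q l w).map (LinearMap.mulLeft ℂ (monomial D 1 - monomial D' c)) ⊔
        restrictSupport ℂ {d | p * d 0 + q * d 1 = w ∧ ¬ D ≤ d} := by
  obtain ⟨a, ha, ha'⟩ := h.exists_index
  rw [weightPoly, restrictSupport_eq_span, Submodule.span_le]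
  rintro _ ⟨d, hd, rfl⟩
  simp only [Set.mem_ofPred_eq, add_zero] at hd
  -- Each replacement strictly lowers the exponent of the variable `a`, which occurs in `x^D` and
  -- not in `x^{D'}`.
  induction hn : d a using Nat.strong_induction_on generalizing d with
  | _ n ih =>
    by_cases hD : D ≤ d
    · obtain ⟨e, rfl⟩ := exists_add_of_le hD
      simp only [Finsupp.add_apply] at hd hn
      have hl := h.weight_lead
      have key : monomial (D + e) (1 : ℂ) =
          (monomial D 1 - monomial D' c) * monomial e 1 + c • monomial (D' + e) 1 := by
        rw [sub_mul, monomial_mul, monomial_mul, smul_monomial]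
        simp
      simp only [SetLike.mem_coe] at ih ⊢
      rw [key]
      refine add_mem (Submodule.mem_sup_left ⟨monomial e 1, ?_, rfl⟩) ?_
      · refine (monomial_mem_restrictSupport ℂ).2 (Or.inl ?_)
        simp only [Set.mem_ofPred_eq]
        linarith
      · rcases h.weight_tail with rfl | ht
        · simp
        · refine Submodule.smul_mem _ _ (ih (e a) (by omega) _ ?_ (by simp [ha']))
          simp only [Finsupp.add_apply]
          linarith
    · exact Submodule.mem_sup_right ((monomial_mem_restrictSupport ℂ).2 (Or.inl ⟨hd, hD⟩))

/-- By `eq_of_not_le` the remainder has at most one monomial. It vanishes at `P` while the monomial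
itself does not, so it is zero. -/
theorem IsOrbitCurve.exists_eq_mul {l : ℕ} {D D' : Fin 2 →₀ ℕ} {c : ℂ}
    (h : IsOrbitCurve p q l D D' c) {P : Fin 2 → ℂ}
    (hP : ∀ d, ¬ D ≤ d → eval P (monomial d 1) ≠ 0)
    (hg : eval P (monomial D 1 - monomial D' c) = 0) {w : ℕ} {F : MvPolynomial (Fin 2) ℂ}
    (hF : F ∈ weightPoly p q 0 w) (hFP : eval P F = 0) :
    ∃ H ∈ weightPoly p q l w, F = (monomial D 1 - monomial D' c) * H := by
  obtain ⟨_, ⟨H, hH, rfl⟩, R, hR, rfl⟩ := Submodule.mem_sup.1 (h.weightPoly_le w hF)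
  refine ⟨H, hH, ?_⟩
  have hR0 : eval P R = 0 := by simpa [hg] using hFP
  suffices R = 0 by simp [this]
  by_contra hne
  obtain ⟨d, hd⟩ := ne_zero_iff.1 hne
  have hd' := hR (mem_support_iff.2 hd)
  have hRd : R = monomial d (coeff d R) := by
    classical
    ext e
    rw [coeff_monomial]
    split_ifs with hde
    · rw [hde]
    · by_contra he
      have he' := hR (mem_support_iff.2 he)
      exact hde (h.eq_of_not_le _ _ (hd'.1.trans he'.1.symm) hd'.2 he'.2)
  rw [hRd, ← mul_one (coeff d R), ← smul_eq_mul, ← smul_monomial, smul_eval, mul_eq_zero] at hR0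
  exact hR0.elim hd (hP d hd'.2)

/-- Let `g` be the binomial. Euler's formula gives `f(P) = 0`, so `f = g H`. Differentiating at `P`,
where some partial derivative of `g` is nonzero, gives `H(P) = 0`, so `g` also divides `H`. Then
`g²` divides `f`, although `g(0) = 0` makes `g` a nonunit. -/
theorem IsOrbitCurve.false_of_squarefree {l : ℕ} {D D' : Fin 2 →₀ ℕ} {c : ℂ}
    (h : IsOrbitCurve p q l D D' c) {P : Fin 2 → ℂ}
    (hP : ∀ d, ¬ D ≤ d → eval P (monomial d 1) ≠ 0)
    (hg : eval P (monomial D 1 - monomial D' c) = 0)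
    (hg' : ∃ i, eval P (pderiv i (monomial D 1 - monomial D' c)) ≠ 0)
    (hm : 0 < m) (hf : ∀ d, coeff d f ≠ 0 → p * d 0 + q * d 1 = m)
    (hsq : Squarefree (polyGerm f)) (h0 : eval P (pderiv 0 f) = 0) (h1 : eval P (pderiv 1 f) = 0) :
    False := by
  have hm' : (m : ℂ) ≠ 0 := by exact_mod_cast hm.ne'
  have hfP : eval P f = 0 := by
    have := congrArg (eval P) (weighted_euler hf)
    simpa [smul_eval, h0, h1, hm'] using this
  obtain ⟨H, hH, hfH⟩ := h.exists_eq_mul hP hg (w := m)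
    (mem_restrictSupport_of_coeff (by simpa using hf)) hfP
  obtain ⟨i, hi⟩ := hg'
  have hHP : eval P H = 0 := by
    have hfi : eval P (pderiv i f) = 0 := by
      fin_cases i
      · exact h0
      · exact h1
    rw [hfH, pderiv_mul, map_add, map_mul, map_mul, hg, zero_mul, add_zero] at hfi
    exact (mul_eq_zero.1 hfi).resolve_left hi
  obtain ⟨H', -, hHH'⟩ := h.exists_eq_mul hP hg (w := m - l) (F := H)
    (mem_restrictSupport_of_coeff fun d hd => by
      have := hH (mem_support_iff.2 hd)
      simp only [Set.mem_ofPred_eq] at this ⊢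
      omega) hHP
  have hunit := hsq (polyGerm (monomial D 1 - monomial D' c)) ⟨polyGerm H', by
    rw [hfH, hHH']
    simp only [← polyGermHom_apply, map_mul]
    ring⟩
  have hunit' := (hunit.map convergentSeries.val).map
    (MvPowerSeries.constantCoeff (σ := Fin 2) (R := ℂ))
  obtain ⟨a, ha, -⟩ := h.exists_index
  have hD : D ≠ 0 := by rintro rfl; simp at ha
  have hc : MvPowerSeries.constantCoeff (convergentSeries.val
      (polyGerm (monomial D 1 - monomial D' c))) = 0 := by
    classical
    rw [← MvPowerSeries.coeff_zero_eq_constantCoeff_apply]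
    simp only [Subalgebra.coe_val, coe_polyGerm, coeff_coe, coeff_sub, coeff_monomial, hD,
      h.tail_ne_zero, if_false, sub_zero]
  rw [hc] at hunit'
  exact not_isUnit_zero hunit'

/-- A point `P ≠ 0` lies on one of three types of orbit closure: `x = 0`, `y = 0`, or `x^{p'} = c
y^{q'}` when both coordinates are nonzero. -/
theorem eq_zero_of_eval_pderiv_eq_zero (hp : 0 < p) (hq : 0 < q) (hm : 0 < m)
    (hf : ∀ d, coeff d f ≠ 0 → p * d 0 + q * d 1 = m) (hsq : Squarefree (polyGerm f))
    {P : Fin 2 → ℂ} (h0 : eval P (pderiv 0 f) = 0) (h1 : eval P (pderiv 1 f) = 0) : P = 0 := by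
  have hmon (d : Fin 2 →₀ ℕ) : eval P (monomial d 1) = P 0 ^ d 0 * P 1 ^ d 1 := by
    rw [eval_monomial, Finsupp.prod_fintype _ _ (by simp), Fin.prod_univ_two, one_mul]
  by_contra hP
  by_cases hx : P 0 = 0
  · have hy : P 1 ≠ 0 := fun hy => hP (by ext i; fin_cases i <;> simpa)
    refine IsOrbitCurve.false_of_squarefree (p := p) (q := q) (l := p) (D := Finsupp.single 0 1)
      (D' := Finsupp.single 1 1) (c := 0) (P := P) ⟨by simp, Or.inl rfl, ⟨0, by simp⟩, by simp, ?_⟩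
      ?_ (by simp [hmon, hx]) ⟨0, by simp⟩ hm hf hsq h0 h1
    · intro d d' hw hd hd'
      simp only [Finsupp.single_le_iff, not_le, Nat.lt_one_iff] at hd hd'
      rw [hd, hd'] at hw
      ext i; fin_cases i
      · exact hd.trans hd'.symm
      · exact Nat.eq_of_mul_eq_mul_left hq (by simpa using hw)
    · intro d hd
      simp only [Finsupp.single_le_iff, not_le, Nat.lt_one_iff] at hd
      simp [hmon, hd, hy]
  by_cases hy : P 1 = 0
  · refine IsOrbitCurve.false_of_squarefree (p := p) (q := q) (l := q) (D := Finsupp.single 1 1)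
      (D' := Finsupp.single 0 1) (c := 0) (P := P) ⟨by simp, Or.inl rfl, ⟨1, by simp⟩, by simp, ?_⟩
      ?_ (by simp [hmon, hy]) ⟨1, by simp⟩ hm hf hsq h0 h1
    · intro d d' hw hd hd'
      simp only [Finsupp.single_le_iff, not_le, Nat.lt_one_iff] at hd hd'
      rw [hd, hd'] at hw
      ext i; fin_cases i
      · exact Nat.eq_of_mul_eq_mul_left hp (by simpa using hw)
      · exact hd.trans hd'.symm
    · intro d hd
      simp only [Finsupp.single_le_iff, not_le, Nat.lt_one_iff] at hd
      simp [hmon, hd, hx]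
  obtain ⟨t, ht⟩ : ∃ t, t = Nat.gcd p q := ⟨_, rfl⟩
  have ht0 : 0 < t := ht ▸ Nat.gcd_pos_of_pos_left q hp
  obtain ⟨q', hq'⟩ : t ∣ p := ht ▸ Nat.gcd_dvd_left p q
  obtain ⟨p', hp'⟩ : t ∣ q := ht ▸ Nat.gcd_dvd_right p q
  have hcop : Nat.Coprime q' p' := by
    have := Nat.coprime_div_gcd_div_gcd (ht ▸ ht0)
    rwa [← ht, hq', hp', Nat.mul_div_cancel_left _ ht0, Nat.mul_div_cancel_left _ ht0] at this
  have hp'0 : 0 < p' := Nat.pos_of_mul_pos_left (hp' ▸ hq)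
  have hq'0 : 0 < q' := Nat.pos_of_mul_pos_left (hq' ▸ hp)
  -- With `p = t q'` and `q = t p'`, both terms have weight `t p' q'`, and `c` is chosen so that the
  -- curve passes through `P`.
  refine IsOrbitCurve.false_of_squarefree (p := p) (q := q) (l := p * p')
    (D := Finsupp.single 0 p') (D' := Finsupp.single 1 q') (c := P 0 ^ p' / P 1 ^ q') (P := P)
    ⟨by simp, Or.inr (by simp [hq', hp']; ring), ⟨0, by simpa⟩, by simpa using hq'0.ne', ?_⟩
    ?_ ?_ ⟨0, ?_⟩ hm hf hsq h0 h1
  · intro d d' hw hd hd'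
    simp only [Finsupp.single_le_iff, not_le] at hd hd'
    have hw' : q' * d 0 + p' * d 1 = q' * d' 0 + p' * d' 1 := by
      refine Nat.eq_of_mul_eq_mul_left ht0 ?_
      rw [hp', hq'] at hw
      linarith
    -- As `q'` and `p'` are coprime, the weight determines the `x`-exponent modulo `p'`, hence
    -- determines it among exponents below `p'`.
    have hmod : d 0 ≡ d' 0 [MOD p'] := by
      have : q' * d 0 ≡ q' * d' 0 [MOD p'] := by
        have h2 : (q' * d 0 + p' * d 1) % p' = (q' * d' 0 + p' * d' 1) % p' := by rw [hw']
        simpa [Nat.ModEq] using h2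
      exact Nat.ModEq.cancel_left_of_coprime hcop.symm this
    have hd0 : d 0 = d' 0 := Nat.ModEq.eq_of_lt_of_lt hmod hd hd'
    rw [hd0] at hw'
    ext i; fin_cases i
    · exact hd0
    · exact Nat.eq_of_mul_eq_mul_left hp'0 (by simpa using hw')
  · intro d _
    simp [hmon, hx, hy]
  · have : eval P (monomial (Finsupp.single 1 q') (P 0 ^ p' / P 1 ^ q')) = P 0 ^ p' := by
      rw [eval_monomial, Finsupp.prod_fintype _ _ (by simp), Fin.prod_univ_two]
      simp [hy]
    rw [map_sub, this, hmon]
    simp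
  · simp [pderiv_monomial, eval_monomial, hx, hp'0.ne']

theorem exists_X_pow_mem_span_pderiv (hp : 0 < p) (hq : 0 < q) (hm : 0 < m)
    (hf : ∀ d, coeff d f ≠ 0 → p * d 0 + q * d 1 = m) (hsq : Squarefree (polyGerm f))
    (i : Fin 2) : ∃ N, X i ^ N ∈ Ideal.span {pderiv 0 f, pderiv 1 f} := by
  change X i ∈ (Ideal.span {pderiv 0 f, pderiv 1 f}).radical
  rw [← vanishingIdeal_zeroLocus_eq_radical (K := ℂ)]
  intro P hP
  have h0 := hP _ (Ideal.subset_span (Set.mem_insert _ _))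
  have h1 := hP _ (Ideal.subset_span (Set.mem_insert_of_mem _ rfl))
  rw [eq_zero_of_eval_pderiv_eq_zero hp hq hm hf hsq (P := P) (by simpa using h0)
    (by simpa using h1)]
  simp

end Isolated

/-! ### All relations for `x^a + y^b`. -/

section Brieskorn
variable {a b : ℕ}

theorem pderiv_zero_brieskorn (a b : ℕ) :
    pderiv 0 (brieskorn a b) = (a : ℂ) • X 0 ^ (a - 1) := by
  simp [brieskorn, pderiv_X, smul_eq_C_mul]

theorem pderiv_one_brieskorn (a b : ℕ) :
    pderiv 1 (brieskorn a b) = (b : ℂ) • X 1 ^ (b - 1) := by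
  simp [brieskorn, pderiv_X, smul_eq_C_mul]

theorem coeff_brieskorn_ne_zero {d : Fin 2 →₀ ℕ} (hd : coeff d (brieskorn a b) ≠ 0) :
    d = Finsupp.single 0 a ∨ d = Finsupp.single 1 b := by
  classical
  rw [brieskorn, coeff_add, coeff_X_pow, coeff_X_pow] at hd
  by_contra! h
  rw [if_neg h.1.symm, if_neg h.2.symm] at hd
  simp at hd

theorem coeff_single_zero_brieskorn (ha : 1 ≤ a) :
    coeff (Finsupp.single 0 a) (brieskorn a b) = 1 := by
  classical
  rw [brieskorn, coeff_add, coeff_X_pow, coeff_X_pow, if_pos rfl, if_neg, add_zero]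
  intro h
  have := DFunLike.congr_fun h 0
  simp at this
  omega

theorem weight_brieskorn (d : Fin 2 →₀ ℕ) (hd : coeff d (brieskorn a b) ≠ 0) :
    b * d 0 + a * d 1 = a * b := by
  rcases coeff_brieskorn_ne_zero hd with rfl | rfl <;> simp [mul_comm]

theorem le_degree_brieskorn (hab : a ≤ b) (d : Fin 2 →₀ ℕ) (hd : coeff d (brieskorn a b) ≠ 0) :
    a ≤ d 0 + d 1 := by
  rcases coeff_brieskorn_ne_zero hd with rfl | rfl <;> simp [hab]

/-- Orders of power series add under multiplication, and the term `x^a` shows that `x^a + y^b` has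
order at most `a`. -/
theorem le_degree_of_mul_brieskorn (ha : 1 ≤ a) {k : ℕ} {u : MvPolynomial (Fin 2) ℂ}
    (hu : ∀ d, coeff d (u * brieskorn a b) ≠ 0 → k ≤ d 0 + d 1) (d : Fin 2 →₀ ℕ)
    (hd : coeff d u ≠ 0) : k ≤ d 0 + d 1 + a := by
  have h1 : (k : ℕ∞) ≤ MvPowerSeries.order
      (((u * brieskorn a b : MvPolynomial (Fin 2) ℂ)) : MvPowerSeries (Fin 2) ℂ) := by
    refine MvPowerSeries.nat_le_order fun e he => ?_
    rw [coeff_coe]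
    by_contra h
    have := hu e h
    rw [degree_fin_two] at he
    omega
  have h2 : MvPowerSeries.order (u : MvPowerSeries (Fin 2) ℂ) ≤ d.degree :=
    MvPowerSeries.order_le (by rwa [coeff_coe])
  have h3 : MvPowerSeries.order (brieskorn a b : MvPowerSeries (Fin 2) ℂ) ≤
      (Finsupp.single 0 a : Fin 2 →₀ ℕ).degree :=
    MvPowerSeries.order_le (by rw [coeff_coe, coeff_single_zero_brieskorn ha]; exact one_ne_zero)
  rw [coe_mul, MvPowerSeries.order_mul] at h1
  have h4 := h1.trans (add_le_add h2 h3)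
  rw [Finsupp.degree_single, degree_fin_two] at h4
  exact_mod_cast h4

/-- Up to constants the partial derivatives are `x^{a-1}` and `y^{b-1}`, which are coprime, so every
relation between them is Koszul. -/
theorem eq_mul_pderiv_of_brieskorn (ha : 1 ≤ a) (hab : a ≤ b) {α β : MvPolynomial (Fin 2) ℂ}
    (h : α * pderiv 0 (brieskorn a b) + β * pderiv 1 (brieskorn a b) = 0) :
    ∃ u, α = u * pderiv 1 (brieskorn a b) ∧ β = -(u * pderiv 0 (brieskorn a b)) := by
  have ha' : (a : ℂ) ≠ 0 := by exact_mod_cast (by omega : a ≠ 0)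
  have hb' : (b : ℂ) ≠ 0 := by exact_mod_cast (by omega : b ≠ 0)
  have hp1 : Prime (X 1 : MvPolynomial (Fin 2) ℂ) := X_prime
  have hdvd : X 1 ^ (b - 1) ∣ X 0 ^ (a - 1) * α := by
    refine ⟨-((b / a : ℂ) • β), ?_⟩
    rw [pderiv_zero_brieskorn, pderiv_one_brieskorn] at h
    have h' : (a : ℂ) • (X 0 ^ (a - 1) * α) = (a : ℂ) • (X 1 ^ (b - 1) * -((b / a : ℂ) • β)) := by
      rw [mul_neg, smul_neg, mul_smul_comm, smul_smul, mul_div_cancel₀ _ ha']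
      rw [mul_smul_comm, mul_smul_comm] at h
      rw [mul_comm (X 0 ^ _), mul_comm (X 1 ^ _)]
      exact eq_neg_of_add_eq_zero_left h
    exact smul_right_injective _ ha' h'
  have hnd : ¬ (X 1 : MvPolynomial (Fin 2) ℂ) ∣ X 0 ^ (a - 1) := fun hd => by
    have := hp1.dvd_of_dvd_pow hd
    rw [X_dvd_X] at this
    simp at this
  obtain ⟨w, rfl⟩ := hp1.pow_dvd_of_dvd_mul_left _ hnd hdvd
  have h1 : X 1 ^ (b - 1) * w = (b : ℂ)⁻¹ • w * pderiv 1 (brieskorn a b) := by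
    rw [pderiv_one_brieskorn, smul_mul_smul_comm, inv_mul_cancel₀ hb', one_smul, mul_comm]
  refine ⟨(b : ℂ)⁻¹ • w, h1, ?_⟩
  have hne : pderiv 1 (brieskorn a b) ≠ 0 := by
    rw [pderiv_one_brieskorn]
    exact smul_ne_zero hb' (pow_ne_zero _ (X_ne_zero _))
  refine mul_right_cancel₀ hne ?_
  rw [h1] at h
  linear_combination h

/-- The component `γ` fixes `v`; subtracting that Euler relation leaves a relation between the
partial derivatives, which fixes `u`. It remains to check the weight and order bounds on `u` and
`v`. -/
theorem gradDomain_inf_ker_le_brieskorn (ha : 1 ≤ a) (hab : a ≤ b) (k s : ℕ) :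
    gradDomain b a (a * b) k s ⊓ LinearMap.ker (gradMap (brieskorn a b)) ≤
      (relDomain b a (a * b) a k s).map (relMap b a (a * b) (brieskorn a b)) := by
  rintro ⟨α, β, γ⟩ h
  obtain ⟨h, hker⟩ := Submodule.mem_inf.1 h
  obtain ⟨hα, h⟩ := Submodule.mem_prod.1 h
  obtain ⟨hβ, hγ⟩ := Submodule.mem_prod.1 h
  dsimp only at hα hβ hγ
  replace hker : α * pderiv 0 (brieskorn a b) + β * pderiv 1 (brieskorn a b) +
    γ * brieskorn a b = 0 := hker
  have ha' : (a : ℂ) ≠ 0 := by exact_mod_cast (by omega : a ≠ 0)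
  have hb' : (b : ℂ) ≠ 0 := by exact_mod_cast (by omega : b ≠ 0)
  have hm : ((a * b : ℕ) : ℂ) ≠ 0 := by push_cast; exact mul_ne_zero ha' hb'
  have heuler := weighted_euler (f := brieskorn a b) weight_brieskorn
  obtain ⟨v, rfl⟩ : ∃ v, γ = -(((a * b : ℕ) : ℂ) • v) :=
    ⟨-(((a * b : ℕ) : ℂ)⁻¹ • γ), by rw [smul_neg, neg_neg, smul_inv_smul₀ hm]⟩
  have hv : v ∈ regionPoly b a (s + a * b) 0 := by
    have := Submodule.smul_mem _ (-((a * b : ℕ) : ℂ)⁻¹) hγ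
    rwa [smul_neg, neg_smul, neg_neg, inv_smul_smul₀ hm] at this
  obtain ⟨u, hu1, hu2⟩ := eq_mul_pderiv_of_brieskorn ha hab
    (α := α - (b : ℂ) • (v * X 0)) (β := β - (a : ℂ) • (v * X 1)) (by
      simp only [smul_eq_C_mul] at heuler hker ⊢
      linear_combination hker - v * heuler)
  have hα' : α = u * pderiv 1 (brieskorn a b) + (b : ℂ) • (v * X 0) := by rw [← hu1]; ring
  have hβ' : β = -(u * pderiv 0 (brieskorn a b)) + (a : ℂ) • (v * X 1) := by rw [← hu2]; ring
  have hudeg (d) (hd : coeff d u ≠ 0) : k + 1 ≤ d 0 + d 1 + a := by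
    refine le_degree_of_mul_brieskorn ha (b := b) (fun e he => ?_) d hd
    -- Eliminating `v` between the formulas for `α` and `β` and applying Euler's formula leaves a
    -- multiple of `u f`, of order at least `k + 1`.
    have h1 : ((a * b : ℕ) : ℂ) • (u * brieskorn a b) =
        (a : ℂ) • (α * X 1) - (b : ℂ) • (β * X 0) := by
      rw [hα', hβ']
      simp only [smul_eq_C_mul] at heuler ⊢
      linear_combination -u * heuler
    have h2 : ((a * b : ℕ) : ℂ) • (u * brieskorn a b) ∈
        restrictSupport ℂ {d : Fin 2 →₀ ℕ | k + 1 ≤ d 0 + d 1} := by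
      rw [h1]
      have h3 (i : Fin 2) (P) (s') (hP : P ∈ regionPoly b a s' k) : P * X i ∈
          restrictSupport ℂ {d : Fin 2 →₀ ℕ | k + 1 ≤ d 0 + d 1} := by
        refine mul_mem_restrictSupport hP 
          (mem_restrictSupport_of_coeff fun e => eq_single_of_coeff_X_ne_zero (i := i)) ?_
        rintro d hd e rfl
        have := hd.2
        simp only [Set.mem_ofPred_eq, Finsupp.add_apply]
        fin_cases i <;> simp <;> omega
      exact sub_mem (Submodule.smul_mem _ _ (h3 1 _ _ hα)) (Submodule.smul_mem _ _ (h3 0 _ _ hβ))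
    refine mem_of_coeff_ne_zero h2 ?_
    rw [coeff_smul]
    exact smul_ne_zero hm he
  refine ⟨(u, v), Submodule.mem_prod.2 ⟨?_, ?_⟩, ?_⟩
  · refine mem_restrictSupport_of_coeff fun d hd => ⟨?_, ?_⟩
    · have h1 : u * pderiv 1 (brieskorn a b) ∈ regionPoly b a (s + a * b + b) 0 := by
        rw [← hu1]
        have hsub : region b a (s + a * b + b) k ⊆ region b a (s + a * b + b) 0 :=
          fun d hd => ⟨hd.1, Nat.zero_le _⟩
        refine sub_mem (restrictSupport_mono ℂ hsub hα) (Submodule.smul_mem _ _ ?_)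
        refine mul_mem_regionPoly hv fun e he => ?_
        rw [eq_single_of_coeff_X_ne_zero he]
        simp; omega
      -- Since `f_y` is a single monomial, the weight bound on `u f_y` passes to `u` without
      -- cancellation.
      have h2 : coeff (d + Finsupp.single 1 (b - 1)) (u * pderiv 1 (brieskorn a b)) ≠ 0 := by
        rw [pderiv_one_brieskorn, mul_smul_comm, coeff_smul, X_pow_eq_monomial,
          coeff_mul_monomial, mul_one]
        exact smul_ne_zero hb' hd
      have h3 := (mem_of_coeff_ne_zero h1 h2).1
      simp only [Finsupp.add_apply] at h3
      obtain ⟨b, rfl⟩ : ∃ b', b = b' + 1 := ⟨b - 1, by omega⟩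
      simp at h3
      nlinarith
    · have := hudeg d hd
      omega
  · refine mem_restrictSupport_of_coeff fun d hd => ⟨(mem_of_coeff_ne_zero hv hd).1, ?_⟩
    -- Here `u f_y` has order at least `(k + 1 - a) + (a - 1)`, so `v x` has order at least `k`.
    have h1 : (b : ℂ) • (v * X 0) ∈ restrictSupport ℂ {d : Fin 2 →₀ ℕ | k ≤ d 0 + d 1} := by
      have : (b : ℂ) • (v * X 0) = α - u * pderiv 1 (brieskorn a b) := by rw [← hu1]; ring
      rw [this]
      have hsub : region b a (s + a * b + b) k ⊆ {d : Fin 2 →₀ ℕ | k ≤ d 0 + d 1} :=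
        fun d hd => hd.2
      refine sub_mem (restrictSupport_mono ℂ hsub hα)
        (mul_mem_restrictSupport (mem_restrictSupport_of_coeff hudeg)
          (mem_restrictSupport_of_coeff (le_degree_pderiv (le_degree_brieskorn hab) 1)) ?_)
      intro d hd e he
      have hd : k + 1 ≤ d 0 + d 1 + a := hd
      have he : a ≤ e 0 + e 1 + 1 := he
      simp only [Set.mem_ofPred_eq, Finsupp.add_apply]
      omega
    have h2 : coeff (d + Finsupp.single 0 1) ((b : ℂ) • (v * X 0)) ≠ 0 := by
      rw [coeff_smul, X, coeff_mul_monomial, mul_one]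
      exact smul_ne_zero hb' hd
    have h3 := mem_of_coeff_ne_zero h1 h2
    simp at h3
    omega
  · simp only [relMap, LinearMap.coe_mk, AddHom.coe_mk, Prod.mk.injEq, and_true]
    exact ⟨hα'.symm, hβ'.symm⟩

end Brieskorn

/-! ### Comparison with `ell`. -/

section Numeric

theorem cast_latticeCount_sub_one (k : ℕ) :
    (latticeCount 1 1 (k - 1) : ℚ) = k * (k - 1) / 2 := by
  have h : (latticeCount 1 1 (k - 1) : ℚ) * 2 = (k - 1 : ℕ) * ((k - 1 : ℕ) + 1) := by
    exact_mod_cast latticeCount_one_one (k - 1)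
  rcases k with _ | k
  · simpa using h
  · simp only [Nat.add_sub_cancel] at h ⊢
    push_cast
    linarith

theorem two_mul_latticeCount_sub (k : ℕ) :
    2 * (latticeCount 1 1 k : ℚ) - latticeCount 1 1 (k - 1) = k * (k + 3) / 2 := by
  have h : (latticeCount 1 1 k : ℚ) * 2 = k * (k + 1) := by
    exact_mod_cast latticeCount_one_one k
  rw [cast_latticeCount_sub_one]
  linarith

theorem ell_nat (k n : ℕ) (b : ℚ) :
    ell k n b = (n - 1) * (b - 1) + k * (k + 3) / 2 - latticeCount 1 1 (k + 1 - n) := by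
  have h : (latticeCount 1 1 (k + 1 - n) : ℚ) * 2 = (k + 1 - n : ℕ) * ((k + 1 - n : ℕ) + 1) := by
    exact_mod_cast latticeCount_one_one (k + 1 - n)
  rw [ell]
  split_ifs with hk
  · rw [Nat.cast_lt] at hk
    rw [Nat.sub_eq_zero_of_le (by omega)] at h ⊢
    push_cast at h
    linarith
  · rw [Nat.cast_lt, not_lt] at hk
    rw [Nat.cast_sub (by omega)] at h
    push_cast at h
    linarith

/-- The term subtracted in `ell` is nonnegative for `k ≥ a`, which settles `a ≤ k < n`. For `k ≥ n`
it can only shrink when `a` is replaced by the larger `n`. -/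
theorem ell_le {k n : ℕ} {a : ℚ} (han : a ≤ n) (b : ℚ) :
    ell k a b ≤ (a - 1) * (b - 1) + k * (k + 3) / 2 - latticeCount 1 1 (k + 1 - n) := by
  have h : (latticeCount 1 1 (k + 1 - n) : ℚ) * 2 = (k + 1 - n : ℕ) * ((k + 1 - n : ℕ) + 1) := by
    exact_mod_cast latticeCount_one_one (k + 1 - n)
  rw [ell]
  rcases lt_or_ge k n with hkn | hkn
  · rw [Nat.sub_eq_zero_of_le (by omega)] at h ⊢
    push_cast at h
    split_ifs with hk
    · linarith
    · push Not at hk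
      nlinarith
  · rw [Nat.cast_sub (by omega)] at h
    push_cast at h
    have hkn' : (n : ℚ) ≤ k := by exact_mod_cast hkn
    rw [if_neg (by linarith)]
    nlinarith

end Numeric

/-! ### The two estimates and the passage to integer weights. -/

theorem ell_le_tjurinaNumber {p q m n : ℕ} (hp : 0 < p) (hq : 0 < q) (hm : 0 < m)
    {f : MvPolynomial (Fin 2) ℂ} (hf0 : f ≠ 0)
    (hf : ∀ d, coeff d f ≠ 0 → p * d 0 + q * d 1 = m)
    (hn : ∀ d, coeff d f ≠ 0 → n ≤ d 0 + d 1) (hpn : (m / p : ℚ) ≤ n) (k : ℕ)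
    [Module.Finite ℂ (TjurinaAlgebra k (polyGerm f))] :
    ell k (m / p) (m / q) ≤ tjurinaNumber k (polyGerm f) := by
  obtain ⟨s, hs, hΔ⟩ := exists_le_latticeDiff hp hq m ((p + q) * (k + 1))
  have h : (latticeDiff p q m s : ℚ) + 2 * latticeCount 1 1 k - latticeCount 1 1 (k - 1) -
      latticeCount 1 1 (k + 1 - n) ≤ tjurinaNumber k (polyGerm f) := by
    exact_mod_cast latticeDiff_le_finrank hp hq hm hf0 hf hn hs
      (hfin := ‹Module.Finite ℂ (TjurinaAlgebra k (polyGerm f))›)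
  have hΔ' : ((m : ℚ) - p) * (m - q) ≤ p * q * latticeDiff p q m s := by exact_mod_cast hΔ
  have hp' : (0 : ℚ) < p := by exact_mod_cast hp
  have hq' : (0 : ℚ) < q := by exact_mod_cast hq
  have hd : ((m / p : ℚ) - 1) * (m / q - 1) ≤ latticeDiff p q m s := by
    have : ((m / p : ℚ) - 1) * (m / q - 1) = ((m : ℚ) - p) * (m - q) / (p * q) := by
      field_simp
    rw [this, div_le_iff₀ (by positivity)]
    linarith
  have h1 := ell_le (k := k) hpn (m / q)
  have h2 := two_mul_latticeCount_sub k
  linarith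

theorem tjurinaNumber_brieskorn {a b : ℕ} (ha : 1 ≤ a) (hab : a ≤ b) (k : ℕ) :
    Module.Finite ℂ (TjurinaAlgebra k (polyGerm (brieskorn a b))) ∧
      (tjurinaNumber k (polyGerm (brieskorn a b)) : ℚ) = ell k a b := by
  have ha' : (a : ℂ) ≠ 0 := by exact_mod_cast (by omega : a ≠ 0)
  have hb' : (b : ℂ) ≠ 0 := by exact_mod_cast (by omega : b ≠ 0)
  have hb : 0 < b := by omega
  have hm : 0 < a * b := Nat.mul_pos ha hb
  have hf0 : brieskorn a b ≠ 0 :=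
    ne_zero_iff.2 ⟨_, by rw [coeff_single_zero_brieskorn ha]; exact one_ne_zero⟩
  have hspan {P : MvPolynomial (Fin 2) ℂ} {c : ℂ} (hc : c ≠ 0) {I : Ideal (MvPolynomial (Fin 2) ℂ)}
      (h : c • P ∈ I) : P ∈ I := by
    have := Submodule.smul_of_tower_mem I c⁻¹ h
    rwa [inv_smul_smul₀ hc] at this
  have hM := maxIdeal_pow_le_tjurinaIdeal (f := brieskorn a b) (a := a - 1) (b := b - 1)
    (hspan ha' (by rw [← pderiv_zero_brieskorn a b]; exact Ideal.subset_span (by simp)))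
    (hspan hb' (by rw [← pderiv_one_brieskorn a b]; exact Ideal.subset_span (by simp))) k
  have hfin : Module.Finite ℂ (TjurinaAlgebra k (polyGerm (brieskorn a b))) :=
    finite_quotient_of_maxIdeal_pow_le hM
  have haq : (0 : ℚ) < a := by exact_mod_cast ha
  have hbq : (0 : ℚ) < b := by exact_mod_cast hb
  refine ⟨hfin, le_antisymm ?_ ?_⟩
  -- The weights are `p = b`, `q = a`, `m = a b`. The first summand makes `s` large enough for the
  -- monomial counts, the second for the kernel of the truncation to lie in the ideal.
  · obtain ⟨s, hs, hΔ⟩ := exists_latticeDiff_le hb ha (a * b)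
      ((b + a) * (k + 1) + (b + a) * (k + (a - 1 + (b - 1))))
    have h : (tjurinaNumber k (polyGerm (brieskorn a b)) : ℚ) ≤
        (latticeDiff b a (a * b) s : ℚ) + 2 * latticeCount 1 1 k - latticeCount 1 1 (k - 1) -
          latticeCount 1 1 (k + 1 - a) := by
      exact_mod_cast finrank_le_latticeDiff hb ha hm hf0 weight_brieskorn (by omega) (by omega) hM
        (gradDomain_inf_ker_le_brieskorn ha hab k s)
    have hΔ' : (b : ℚ) * a * latticeDiff b a (a * b) s ≤ (a * b - b) * (a * b - a) := by
      exact_mod_cast hΔ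
    have hd : (latticeDiff b a (a * b) s : ℚ) ≤ (a - 1) * (b - 1) := by
      refine le_of_mul_le_mul_left (hΔ'.trans (le_of_eq ?_)) (mul_pos hbq haq)
      ring
    rw [ell_nat]
    have h2 := two_mul_latticeCount_sub k
    linarith
  · have h := ell_le_tjurinaNumber hb ha hm hf0 weight_brieskorn (le_degree_brieskorn hab)
      (by push_cast; rw [mul_div_cancel_right₀ _ hbq.ne']) k
    push_cast at h
    rwa [mul_div_cancel_right₀ _ hbq.ne', mul_div_cancel_left₀ _ haq.ne'] at h

theorem finite_tjurinaAlgebra {p q m : ℕ} (hp : 0 < p) (hq : 0 < q) (hm : 0 < m)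
    {f : MvPolynomial (Fin 2) ℂ} (hf : ∀ d, coeff d f ≠ 0 → p * d 0 + q * d 1 = m)
    (hsq : Squarefree (polyGerm f)) (k : ℕ) :
    Module.Finite ℂ (TjurinaAlgebra k (polyGerm f)) := by
  obtain ⟨a, ha⟩ := exists_X_pow_mem_span_pderiv hp hq hm hf hsq 0
  obtain ⟨b, hb⟩ := exists_X_pow_mem_span_pderiv hp hq hm hf hsq 1
  exact finite_quotient_of_maxIdeal_pow_le (maxIdeal_pow_le_tjurinaIdeal ha hb k)

theorem IsOfWeightType.exists_nat {w₁ w₂ : ℚ} {f : MvPolynomial (Fin 2) ℂ}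
    (h : IsOfWeightType w₁ w₂ f) :
    ∃ p q m : ℕ, 0 < p ∧ 0 < q ∧ 0 < m ∧ 1 / w₁ = m / p ∧ 1 / w₂ = m / q ∧
      ∀ d, coeff d f ≠ 0 → p * d 0 + q * d 1 = m := by
  obtain ⟨h1, h2, h⟩ := h
  obtain ⟨n₁, hn₁⟩ := Int.eq_ofNat_of_zero_le (Rat.num_pos.2 h1).le
  obtain ⟨n₂, hn₂⟩ := Int.eq_ofNat_of_zero_le (Rat.num_pos.2 h2).le
  have hn₁0 : 0 < n₁ := by have := Rat.num_pos.2 h1; omega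
  have hn₂0 : 0 < n₂ := by have := Rat.num_pos.2 h2; omega
  have hd₁ : (0 : ℚ) < w₁.den := by exact_mod_cast w₁.den_pos
  have hd₂ : (0 : ℚ) < w₂.den := by exact_mod_cast w₂.den_pos
  have hn₁q : (0 : ℚ) < n₁ := by exact_mod_cast hn₁0
  have hn₂q : (0 : ℚ) < n₂ := by exact_mod_cast hn₂0
  have hw₁ : w₁ = n₁ / w₁.den := by
    conv_lhs => rw [← Rat.num_div_den w₁, hn₁]
    simp
  have hw₂ : w₂ = n₂ / w₂.den := by
    conv_lhs => rw [← Rat.num_div_den w₂, hn₂]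
    simp
  refine ⟨n₁ * w₂.den, n₂ * w₁.den, w₁.den * w₂.den, Nat.mul_pos hn₁0 w₂.den_pos,
    Nat.mul_pos hn₂0 w₁.den_pos, Nat.mul_pos w₁.den_pos w₂.den_pos, ?_, ?_, fun d hd => ?_⟩
  · conv_lhs => rw [hw₁]
    push_cast
    field_simp
  · conv_lhs => rw [hw₂]
    push_cast
    field_simp
  · have hw := h hd
    rw [Finsupp.weight_apply, Finsupp.sum_fintype _ _ (by simp), Fin.sum_univ_two] at hw
    simp only [nsmul_eq_mul, Matrix.cons_val_zero, Matrix.cons_val_one] at hw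
    rw [hw₁, hw₂] at hw
    field_simp at hw
    have : ((n₁ * w₂.den * d 0 + n₂ * w₁.den * d 1 : ℕ) : ℚ) = (w₁.den * w₂.den : ℕ) := by
      push_cast
      linarith
    exact_mod_cast this

end PlaneCurve

end

theorem mainTheorem7 :
    (∀ a b k : ℕ, 1 ≤ a → a ≤ b →
      Module.Finite ℂ (PlaneCurve.TjurinaAlgebra k (PlaneCurve.polyGerm (PlaneCurve.brieskorn a b))) ∧
      (PlaneCurve.tjurinaNumber k (PlaneCurve.polyGerm (PlaneCurve.brieskorn a b)) : ℚ) =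
        PlaneCurve.ell k a b) ∧
    (∀ (f : MvPolynomial (Fin 2) ℂ) (w₁ w₂ : ℚ),
      PlaneCurve.IsOfWeightType w₁ w₂ f →
      Squarefree (PlaneCurve.polyGerm f) →
      1 / w₁ ≤ (PlaneCurve.algMultiplicity (PlaneCurve.polyGerm f) : ℚ) →
      ∀ k : ℕ,
        Module.Finite ℂ (PlaneCurve.TjurinaAlgebra k (PlaneCurve.polyGerm f)) ∧
        PlaneCurve.ell k (1 / w₁) (1 / w₂) ≤
          (PlaneCurve.tjurinaNumber k (PlaneCurve.polyGerm f) : ℚ)) := by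
  refine ⟨fun a b k ha hab => PlaneCurve.tjurinaNumber_brieskorn ha hab k,
    fun f w₁ w₂ hw hsq hν k => ?_⟩
  obtain ⟨p, q, m, hp, hq, hm, h1, h2, hf⟩ := hw.exists_nat
  have hfin := PlaneCurve.finite_tjurinaAlgebra hp hq hm hf hsq k
  refine ⟨hfin, ?_⟩
  rw [h1] at hν
  rw [h1, h2]
  refine PlaneCurve.ell_le_tjurinaNumber hp hq hm ?_ hf (fun d hd => ?_) hν k
  · rintro rfl
    refine hsq.ne_zero ?_
    rw [← PlaneCurve.polyGermHom_apply, map_zero]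
  · rw [PlaneCurve.algMultiplicity, ← PlaneCurve.degree_fin_two]
    refine ENat.toNat_le_of_le_natCast (MvPowerSeries.order_le ?_)
    rwa [PlaneCurve.coe_polyGerm, MvPolynomial.coeff_coe]
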